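/- Let $K$ be a compact Hausdorff space that is dispersed (scattered), i.e. contains no non-empty perfect subset, and let $X=C(K)$ be the Banach space of continuous complex-valued functions on $K$ with the supremum norm. Let $B$ be the open unit ball of $X$, let $\overline{B}^{**}$ be the closed unit ball of the bidual $X^{**}$, and let $H^\infty(B)$ be the Banach algebra of all bounded analytic functions $f:B\to\mathbb{C}$ with the supremum norm. Let $M$ be the spectrum of $H^\infty(B)$, i.e. the set of all non-zero multiplicative linear functionals $\tau:H^\infty(B)\to\mathbb{C}$, and let $\widehat f(\tau)=\tau(f)$ be the Gelfand transform of $f\in H^\infty(B)$. For $x^{**}\in\overline{B}^{**}$ let $$M_{x^{**}}=\{\tau\in M:\ \tau(x^*|_B)=x^{**}(x^*)\ \text{for all } x^*\in X^*\}$$ be the fiber of $M$ over $x^{**}$, and for $f\in H^\infty(B)$ let $Cl_B(f,x^{**})$ be the cluster set of $f$ at $x^{**}$, i.e. the set of all limits $\lim_\alpha f(x_\alpha)$ along nets $(x_\alpha)$ in $B$ that converge to $x^{**}$ in the weak-star topology of $X^{**}$. Then the cluster value theorem holds for $H^\infty(B)$ at every point of $\overline{B}^{**}$: $$Cl_B(f,x^{**})=\widehat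 f(M_{x^{**}})\qquad\text{for every } x^{**}\in\overline{B}^{**}\text{ and every } f\in H^\infty(B).$$ -/

import Mathlib

open Filter Topology BoundedContinuousFunction

noncomputable section

/-- A topological space is dispersed (scattered) if it contains no non-empty perfect subset. -/
def IsDispersed (K : Type*) [TopologicalSpace K] : Prop :=
  ∀ C : Set K, Perfect C → C = ∅

section ClusterValues

variable (X : Type*) [NormedAddCommGroup X] [NormedSpace ℂ X]

/-- The open unit ball `B` of `X`. -/
abbrev UnitBall : Set X := Metric.ball (0 : X) 1

/-- The algebra `H^∞(B)` of all bounded analytic functions on the open unit ball `B` of `X`, with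
the supremum norm. Analyticity on the open set `B` is complex Fréchet differentiability at every
point of `B`; as functions here live on `B` itself, it is expressed through an extension to `X`,
whose values off `B` play no role. -/
def HInf : Subalgebra ℂ (UnitBall X →ᵇ ℂ) where
  carrier := {f | ∃ F : X → ℂ, DifferentiableOn ℂ F (UnitBall X) ∧ ∀ x : UnitBall X, F x = f x}
  mul_mem' := by
    rintro f g ⟨F, hF, hFf⟩ ⟨G, hG, hGg⟩
    exact ⟨F * G, hF.mul hG, fun x => by simp [hFf, hGg]⟩
  add_mem' := by
    rintro f g ⟨F, hF, hFf⟩ ⟨G, hG, hGg⟩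
    exact ⟨F + G, hF.add hG, fun x => by simp [hFf, hGg]⟩
  algebraMap_mem' c := ⟨fun _ => c, differentiableOn_const c, fun _ => rfl⟩

variable {X}

/-- The restriction `x*|_B` of a bounded linear functional, as an element of `H^∞(B)`. -/
def restrictFun (φ : StrongDual ℂ X) : HInf X :=
  ⟨BoundedContinuousFunction.ofNormedAddCommGroup (fun x : UnitBall X => φ x) (by fun_prop) ‖φ‖
    (fun x => by
      have hx : ‖(x : X)‖ ≤ 1 := (mem_ball_zero_iff.mp x.2).le
      exact φ.le_of_opNorm_le_of_le le_rfl hx |>.trans (mul_one _).le),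
    φ, φ.differentiable.differentiableOn, fun _ => rfl⟩

variable (X) in
/-- The inclusion `X* ⊂ H^∞(B)`, `x* ↦ x*|_B`, as a bounded linear map. -/
def restrictDual : StrongDual ℂ X →L[ℂ] HInf X :=
  LinearMap.mkContinuous
    { toFun := restrictFun
      map_add' := fun _ _ => rfl
      map_smul' := fun _ _ => rfl } 1
    (fun φ => by
      rw [one_mul]
      refine BoundedContinuousFunction.norm_ofNormedAddCommGroup_le _ (norm_nonneg φ) (fun x => ?_)
      have hx : ‖(x : X)‖ ≤ 1 := (mem_ball_zero_iff.mp x.2).le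
      exact φ.le_of_opNorm_le_of_le le_rfl hx |>.trans (mul_one _).le)

/-- The projection `π(τ) = τ|_{X*}` from the spectrum of `H^∞(B)` to the bidual `X**`. -/
def spectrumProj (τ : WeakDual.characterSpace ℂ (HInf X)) :
    StrongDual ℂ (StrongDual ℂ X) :=
  (WeakDual.toStrongDual (τ : WeakDual ℂ (HInf X))).comp (restrictDual X)

/-- The fiber `M_{x**}(B) = π⁻¹(x**)` of the spectrum of `H^∞(B)` over `x**`. -/
def fiber (x : StrongDual ℂ (StrongDual ℂ X)) : Set (WeakDual.characterSpace ℂ (HInf X)) :=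
  spectrumProj ⁻¹' {x}

/-- The inclusion of `B` in the bidual `X**` with its weak-star topology. -/
def toWeakStarBidual (b : UnitBall X) : WeakDual ℂ (StrongDual ℂ X) :=
  StrongDual.toWeakDual (NormedSpace.inclusionInDoubleDual ℂ X b)

/-- The cluster set `Cl_B(f, x**)`: all limits of values of `f` along nets (here: proper filters)
in `B` that converge weak-star to `x**`. -/
def clusterSet (f : HInf X) (x : StrongDual ℂ (StrongDual ℂ X)) : Set ℂ :=
  {z | ∃ l : Filter (UnitBall X), l.NeBot ∧
    Tendsto toWeakStarBidual l (𝓝 (StrongDual.toWeakDual x)) ∧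
    Tendsto (f : UnitBall X →ᵇ ℂ) l (𝓝 z)}

end ClusterValues

end

/-!
Characters obtained as ultrafilter limits of evaluations show that cluster values are values on the
fiber. Conversely, let `τ` be a character over `x**` and let `w t = x**(δ_t)`. If `τ` is induced by
a character of `H^∞` of every cylinder `{x ∈ B : |x(s) - w(s)| < ε, s ∈ S}`, with `S ⊆ K` finite,
then `τ(f)` is approximated by values of `f` on each cylinder, since otherwise `f - τ(f)` would be
invertible there. The cylinders are handled one point `t` at a time: a bounded holomorphic `g` on
the smaller cylinder agrees up to `O(x(t) - w(t))` with some bounded holomorphic `F` on the larger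
one, and a function `e = O(x(t) - w(t))` is killed by `τ` because `x(t) - w(t)` divides `e³`. To
find `F`, free the value at `t` by blending `x` near `t` with a constant `ζ`, extend `g` in the
variable `ζ`, and let the neighborhood of `t` shrink. If `|w(t)| = 1`, the extension is made in the
strip `0 < Im < π`, to which the disc is mapped with `w(t)` going to the boundary point `0`: Cauchy
integrals over horizontal lines extend a function from the lower half of the strip to all of it.
Finally, over a dispersed `K` the point evaluations span a dense subspace of `C(K)*`, so that on the
ball weak-star convergence is convergence at each point of `K`.
-/

theorem exists_norm_le_tendsto_ultrafilter {F ι : Type*} [NormedAddCommGroup F]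
    [ProperSpace F] (𝒰 : Ultrafilter ι) {a : ι → F} {M : ℝ}
    (h : ∀ᶠ i in 𝒰, ‖a i‖ ≤ M) :
    ∃ z, ‖z‖ ≤ M ∧ Tendsto a 𝒰 (𝓝 z) := by
  obtain ⟨z, hz, hle⟩ := (isCompact_closedBall (0 : F) M).ultrafilter_le_nhds (𝒰.map a)
    (le_principal_iff.mpr (h.mono fun i hi => by simpa using hi))
  exact ⟨z, by simpa using hz, hle⟩

section BoundedHolomorphic

variable {E F : Type*} [NormedAddCommGroup E] [NormedSpace ℂ E]
  [NormedAddCommGroup F] [NormedSpace ℂ F] {f : E → F} {x v : E} {r M : ℝ}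

theorem norm_fderiv_le_of_bounded_on_ball (hr : 0 < r)
    (hf : DifferentiableOn ℂ f (Metric.ball x r)) (hM : ∀ y ∈ Metric.ball x r, ‖f y‖ ≤ M) :
    ‖fderiv ℂ f x‖ ≤ 2 * M / r := by
  refine Complex.norm_fderiv_le_div_of_mapsTo_ball hf (fun y hy => ?_) hr
  rw [mem_closedBall_iff_norm]
  linarith [norm_sub_le (f y) (f x), hM y hy, hM x (Metric.mem_ball_self hr)]

theorem norm_sub_sub_fderiv_le_of_bounded_on_ball (hr : 0 < r)
    (hf : DifferentiableOn ℂ f (Metric.ball x r)) (hM : ∀ y ∈ Metric.ball x r, ‖f y‖ ≤ M)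
    (hv : ‖v‖ < r) :
    ‖f (x + v) - f x - fderiv ℂ f x v‖ ≤ 4 * M / r ^ 2 * ‖v‖ ^ 2 := by
  let g : E → F := fun y => f y - fderiv ℂ f x (y - x)
  have hg : g x = f x := by simp [g]
  have hbound : Set.MapsTo g (Metric.ball x r) (Metric.closedBall (g x) (4 * M)) := fun y hy => by
    have hderiv : ‖fderiv ℂ f x (y - x)‖ ≤ 2 * M := by
      have hD := norm_fderiv_le_of_bounded_on_ball hr hf hM
      calc _ ≤ 2 * M / r * ‖y - x‖ := (fderiv ℂ f x).le_of_opNorm_le hD _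
        _ ≤ 2 * M / r * r := by
          gcongr
          exacts [(norm_nonneg _).trans hD, (mem_ball_iff_norm.mp hy).le]
        _ = 2 * M := by field_simp
    rw [mem_closedBall_iff_norm, hg]
    calc _ ≤ ‖f y‖ + ‖fderiv ℂ f x (y - x)‖ + ‖f x‖ :=
          (norm_sub_le _ _).trans (by gcongr; exact norm_sub_le _ _)
      _ ≤ 4 * M := by linarith [hM y hy, hM x (Metric.mem_ball_self hr)]
  have hlittle : (fun y => g y - g x) =o[𝓝 x] fun y => ‖y - x‖ ^ 1 := by
    have hfx := hf.differentiableAt (Metric.isOpen_ball.mem_nhds (Metric.mem_ball_self hr))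
    simp only [pow_one, hg]
    exact hfx.hasFDerivAt.isLittleO.norm_right.congr_left fun y => sub_right_comm _ _ _
  have key := Complex.dist_le_mul_div_pow_of_mapsTo_ball_of_isLittleO (z := x + v)
    (f := g) (hf.sub (by fun_prop)) hbound hlittle (by simpa using hv)
  rw [hg, dist_eq_norm] at key
  convert key using 1
  · simp only [g, add_sub_cancel_left, sub_right_comm]
  · rw [dist_eq_norm, add_sub_cancel_left]; ring

theorem differentiableAt_of_norm_sub_sub_le (L : E →L[ℂ] F) {C : ℝ} (hr : 0 < r)
    (h : ∀ v, ‖v‖ < r → ‖f (x + v) - f x - L v‖ ≤ C * ‖v‖ ^ 2) : DifferentiableAt ℂ f x := by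
  refine HasFDerivAt.differentiableAt (f' := L) ?_
  rw [hasFDerivAt_iff_isLittleO_nhds_zero]
  have hO : (fun v => f (x + v) - f x - L v) =O[𝓝 0] fun v => ‖v‖ ^ 2 := by
    refine Asymptotics.IsBigO.of_bound C ?_
    filter_upwards [Metric.ball_mem_nhds 0 hr] with v hv
    simpa using h v (by simpa using hv)
  exact hO.trans_isLittleO (Asymptotics.isLittleO_norm_pow_id one_lt_two)

section NormalFamilies

variable [ProperSpace F] {ι : Type*} (𝒰 : Ultrafilter ι)

theorem differentiableAt_of_tendsto_ultrafilter (hr : 0 < r) {g : ι → E → F} {G : E → F}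
    (hg : ∀ᶠ i in 𝒰, DifferentiableOn ℂ (g i) (Metric.ball x r) ∧
      ∀ y ∈ Metric.ball x r, ‖g i y‖ ≤ M)
    (hG : ∀ y ∈ Metric.ball x r, Tendsto (g · y) 𝒰 (𝓝 (G y))) : DifferentiableAt ℂ G x := by
  have hbound : ∀ v, ∀ᶠ i in 𝒰, ‖fderiv ℂ (g i) x v‖ ≤ 2 * M / r * ‖v‖ := fun v =>
    hg.mono fun i hi =>
      (fderiv ℂ (g i) x).le_of_opNorm_le (norm_fderiv_le_of_bounded_on_ball hr hi.1 hi.2) v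
  choose D hDle hD using fun v => exists_norm_le_tendsto_ultrafilter 𝒰 (hbound v)
  let L : E →L[ℂ] F := LinearMap.mkContinuous
    { toFun := D
      map_add' := fun v w => tendsto_nhds_unique (hD (v + w))
        (((hD v).add (hD w)).congr fun i => (map_add _ _ _).symm)
      map_smul' := fun c v => tendsto_nhds_unique (hD (c • v))
        (((hD v).const_smul c).congr fun i => (map_smul _ _ _).symm) } (2 * M / r) hDle
  refine differentiableAt_of_norm_sub_sub_le L hr (C := 4 * M / r ^ 2) fun v hv => ?_
  refine le_of_tendsto (((hG (x + v) (by simpa using hv)).sub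
    (hG x (Metric.mem_ball_self hr))).sub (hD v)).norm ?_
  exact hg.mono fun i hi => norm_sub_sub_fderiv_le_of_bounded_on_ball hr hi.1 hi.2 hv

theorem exists_differentiableOn_tendsto_ultrafilter {V : Set E} (hV : IsOpen V) {g : ι → E → F}
    (hg : ∀ᶠ i in 𝒰, DifferentiableOn ℂ (g i) V ∧ ∀ y ∈ V, ‖g i y‖ ≤ M) :
    ∃ G : E → F, DifferentiableOn ℂ G V ∧ (∀ y ∈ V, ‖G y‖ ≤ M) ∧
      ∀ y ∈ V, Tendsto (g · y) 𝒰 (𝓝 (G y)) := by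
  have hlim : ∀ y, ∃ z, y ∈ V → ‖z‖ ≤ M ∧ Tendsto (g · y) 𝒰 (𝓝 z) := fun y => by
    by_cases hy : y ∈ V
    · obtain ⟨z, hz⟩ := exists_norm_le_tendsto_ultrafilter 𝒰 (hg.mono fun i hi => hi.2 y hy)
      exact ⟨z, fun _ => hz⟩
    · exact ⟨0, fun h => absurd h hy⟩
  choose G hG using hlim
  refine ⟨G, fun x hx => ?_, fun y hy => (hG y hy).1, fun y hy => (hG y hy).2⟩
  obtain ⟨r, hr, hrV⟩ := Metric.isOpen_iff.mp hV x hx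
  exact (differentiableAt_of_tendsto_ultrafilter 𝒰 hr
    (hg.mono fun i hi => ⟨hi.1.mono hrV, fun y hy => hi.2 y (hrV hy)⟩)
    fun y hy => (hG y (hrV hy)).2).differentiableWithinAt

end NormalFamilies

theorem norm_pow_three_div_le {e a : ℂ} {C : ℝ} (h : ‖e‖ ≤ C * ‖a‖) :
    ‖e ^ 3 / a‖ ≤ C ^ 3 * ‖a‖ ^ 2 := by
  by_cases ha : a = 0
  · simp [ha]
  have ha' : 0 < ‖a‖ := norm_pos_iff.mpr ha
  rw [norm_div, norm_pow, div_le_iff₀ ha']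
  calc ‖e‖ ^ 3 ≤ (C * ‖a‖) ^ 3 := by gcongr
    _ = _ := by ring

theorem differentiableOn_pow_three_div {V : Set E} (hV : IsOpen V) {e a : E → ℂ} {C : ℝ}
    (he : DifferentiableOn ℂ e V) (ha : DifferentiableOn ℂ a V)
    (h : ∀ x ∈ V, ‖e x‖ ≤ C * ‖a x‖) : DifferentiableOn ℂ (fun x => e x ^ 3 / a x) V := by
  intro x hx
  have hV' := hV.mem_nhds hx
  by_cases hax : a x = 0
  · refine HasFDerivAt.differentiableAt (f' := 0) ?_ |>.differentiableWithinAt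
    rw [hasFDerivAt_iff_isLittleO]
    have hO : a =O[𝓝 x] fun y => y - x := by
      simpa [hax] using (ha.differentiableAt hV').isBigO_sub
    have : (fun y => e y ^ 3 / a y) =O[𝓝 x] fun y => a y ^ 2 := by
      refine Asymptotics.IsBigO.of_bound (C ^ 3) ?_
      filter_upwards [hV'] with y hy
      simpa using norm_pow_three_div_le (h y hy)
    have := (this.trans (hO.norm_right.pow 2)).trans_isLittleO
      (Asymptotics.isLittleO_pow_sub_sub x one_lt_two)
    simpa [hax] using this
  · simp only [div_eq_mul_inv]
    exact (((he.differentiableAt hV').fun_pow 3).fun_mul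
      ((ha.differentiableAt hV').fun_inv hax)).differentiableWithinAt

section ParametricIntegral

open MeasureTheory

variable {α : Type*} [MeasurableSpace α] {μ : Measure α} {g : α → E → F} {bound : α → ℝ}

theorem aestronglyMeasurable_fderiv_apply (hr : 0 < r)
    (hmeas : ∀ y ∈ Metric.ball x r, AEStronglyMeasurable (g · y) μ)
    (hdiff : ∀ᵐ a ∂μ, DifferentiableOn ℂ (g a) (Metric.ball x r)) (v : E) :
    AEStronglyMeasurable (fun a => fderiv ℂ (g a) x v) μ := by
  have hsmall : Tendsto (fun n : ℕ => (n : ℂ)⁻¹ • v) atTop (𝓝 0) := by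
    simpa using (tendsto_inv_atTop_nhds_zero_nat (𝕜 := ℂ)).smul_const v
  obtain ⟨N, hN⟩ := eventually_atTop.mp (hsmall.eventually (Metric.ball_mem_nhds 0 hr))
  refine aestronglyMeasurable_of_tendsto_ae atTop
    (f := fun (n : ℕ) a => ((n + N : ℕ) : ℂ) • (g a (x + ((n + N : ℕ) : ℂ)⁻¹ • v) - g a x))
    (fun n => ((hmeas _ ?_).sub (hmeas x (Metric.mem_ball_self hr))).const_smul _) ?_
  · simpa using hN (n + N) (Nat.le_add_left N n)
  · filter_upwards [hdiff] with a ha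
    have hax := ha.differentiableAt (Metric.isOpen_ball.mem_nhds (Metric.mem_ball_self hr))
    have hlim := hax.hasFDerivAt.lim v (α := ℕ) (l := atTop) (c := fun n => (n : ℂ))
      (by simpa using tendsto_natCast_atTop_atTop (R := ℝ))
    exact hlim.comp (tendsto_add_atTop_nat N)

theorem differentiableAt_integral_of_dominated (hr : 0 < r)
    (hmeas : ∀ y ∈ Metric.ball x r, AEStronglyMeasurable (g · y) μ)
    (hdiff : ∀ᵐ a ∂μ, DifferentiableOn ℂ (g a) (Metric.ball x r))
    (hbound : ∀ᵐ a ∂μ, ∀ y ∈ Metric.ball x r, ‖g a y‖ ≤ bound a) (hint : Integrable bound μ) :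
    DifferentiableAt ℂ (fun y => ∫ a, g a y ∂μ) x := by
  have hg : ∀ y ∈ Metric.ball x r, Integrable (g · y) μ := fun y hy =>
    hint.mono' (hmeas y hy) (hbound.mono fun a ha => ha y hy)
  have hderiv_le : ∀ v, ∀ᵐ a ∂μ, ‖fderiv ℂ (g a) x v‖ ≤ 2 * bound a / r * ‖v‖ := fun v => by
    filter_upwards [hdiff, hbound] with a hd hb
    exact (fderiv ℂ (g a) x).le_of_opNorm_le (norm_fderiv_le_of_bounded_on_ball hr hd hb) v
  have hderiv : ∀ v, Integrable (fun a => fderiv ℂ (g a) x v) μ := fun v =>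
    (((hint.const_mul 2).div_const r).mul_const ‖v‖).mono'
      (aestronglyMeasurable_fderiv_apply hr hmeas hdiff v) (hderiv_le v)
  let L : E →L[ℂ] F := LinearMap.mkContinuous
    { toFun := fun v => ∫ a, fderiv ℂ (g a) x v ∂μ
      map_add' := fun v w => by simpa only [map_add] using integral_add (hderiv v) (hderiv w)
      map_smul' := fun c v => by simpa only [map_smul] using! integral_smul c _ }
    (∫ a, 2 * bound a / r ∂μ) fun v =>
      (norm_integral_le_of_norm_le (((hint.const_mul 2).div_const r).mul_const ‖v‖)
        (hderiv_le v)).trans_eq (integral_mul_const _ _)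
  refine differentiableAt_of_norm_sub_sub_le L hr (C := ∫ a, 4 * bound a / r ^ 2 ∂μ) fun v hv => ?_
  have hxv := hg (x + v) (by simpa using hv)
  have hx := hg x (Metric.mem_ball_self hr)
  change ‖(∫ a, g a (x + v) ∂μ) - (∫ a, g a x ∂μ) - ∫ a, fderiv ℂ (g a) x v ∂μ‖ ≤ _
  rw [← integral_sub hxv hx, ← integral_sub (by exact hxv.sub hx) (hderiv v), ← integral_mul_const]
  refine norm_integral_le_of_norm_le (((hint.const_mul 4).div_const _).mul_const _) ?_
  filter_upwards [hdiff, hbound] with a hd hb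
  exact norm_sub_sub_fderiv_le_of_bounded_on_ball hr hd hb hv

end ParametricIntegral

end BoundedHolomorphic

section StripCauchyIntegral

open Complex MeasureTheory

/-- The `-πi`-antiperiodised Cauchy kernel `1/s - 1/(s + πi)`: compared with `1/s` it gains
integrability on horizontal lines, and its only pole in `-π < Im s` is `s = 0`. -/
noncomputable def stripKernel (s : ℂ) : ℂ := s⁻¹ - (s + Real.pi * I)⁻¹

/-- The Cauchy integral of `f` over the horizontal line `Im η = c`, taken with `stripKernel`. -/
noncomputable def cauchyLine (c : ℝ) (f : ℂ → ℂ) (v : ℂ) : ℂ :=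
  (2 * Real.pi * I)⁻¹ * ∫ t : ℝ, f (t + c * I) * stripKernel (t + c * I - v)

theorem stripKernel_eq_div {s : ℂ} (h₀ : s ≠ 0) (h₁ : s + Real.pi * I ≠ 0) :
    stripKernel s = s⁻¹ * (Real.pi * I / (s + Real.pi * I)) := by
  rw [stripKernel]; field_simp; ring

theorem im_add_pi_mul_I (s : ℂ) : (s + Real.pi * I).im = s.im + Real.pi := by simp

theorem sq_mul_one_add_sq_re_le {s : ℂ} {d : ℝ} (hd₀ : 0 ≤ d) (hd₁ : d ≤ 1) (h : d ≤ |s.im|) :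
    d ^ 2 * (1 + s.re ^ 2) ≤ ‖s‖ ^ 2 := by
  have him : d ^ 2 ≤ s.im ^ 2 := by simpa using pow_le_pow_left₀ hd₀ h 2
  rw [Complex.sq_norm, normSq_apply]
  nlinarith [mul_nonneg (sub_nonneg.mpr (pow_le_one₀ (n := 2) hd₀ hd₁)) (sq_nonneg s.re)]

theorem norm_stripKernel_le {s : ℂ} {d : ℝ} (hd₀ : 0 < d) (hd₁ : d ≤ 1) (h₀ : d ≤ |s.im|)
    (h₁ : d ≤ |s.im + Real.pi|) : ‖stripKernel s‖ ≤ Real.pi / d ^ 2 * (1 + s.re ^ 2)⁻¹ := by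
  rw [← im_add_pi_mul_I] at h₁
  have hne : ∀ {u : ℂ}, d ≤ |u.im| → u ≠ 0 := by
    rintro _ h rfl
    exact hd₀.not_ge (by simpa using h)
  have hs := sq_mul_one_add_sq_re_le hd₀.le hd₁ h₀
  have hs' := sq_mul_one_add_sq_re_le hd₀.le hd₁ h₁
  have hprod : d ^ 2 * (1 + s.re ^ 2) ≤ ‖s‖ * ‖s + Real.pi * I‖ := by
    refine (pow_le_pow_iff_left₀ (by positivity) (by positivity) two_ne_zero).mp ?_
    have hre : (s + Real.pi * I).re = s.re := by simp
    rw [hre] at hs'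
    rw [mul_pow ‖s‖, sq (_ * _)]
    gcongr
  calc ‖stripKernel s‖ = Real.pi / (‖s‖ * ‖s + Real.pi * I‖) := by
        rw [stripKernel_eq_div (hne h₀) (hne h₁)]
        simp [abs_of_pos Real.pi_pos, field]
    _ ≤ Real.pi / (d ^ 2 * (1 + s.re ^ 2)) := by gcongr
    _ = _ := by field_simp

theorem differentiableAt_stripKernel {s : ℂ} (h₀ : s.im ≠ 0) (h₁ : s.im + Real.pi ≠ 0) :
    DifferentiableAt ℂ stripKernel s := by
  refine (differentiableAt_fun_id.fun_inv ?_).fun_sub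
    ((differentiableAt_fun_id.add_const _).fun_inv ?_)
  · rintro rfl; simp at h₀
  · intro h; rw [← im_add_pi_mul_I, h] at h₁; simp at h₁

theorem integrable_stripKernel_bound (C a : ℝ) :
    Integrable fun t : ℝ => C * (1 + (t - a) ^ 2)⁻¹ :=
  (integrable_inv_one_add_sq.comp_sub_right a).const_mul C

theorem integral_stripKernel_bound (C a : ℝ) :
    ∫ t : ℝ, C * (1 + (t - a) ^ 2)⁻¹ = C * Real.pi := by
  rw [integral_const_mul, integral_sub_right_eq_self (fun t : ℝ => (1 + t ^ 2)⁻¹) a,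
    integral_univ_inv_one_add_sq]

section PoissonKernel

variable {y : ℝ}

theorem div_sq_add_sq_eq (hy : y ≠ 0) (t : ℝ) :
    y / (t ^ 2 + y ^ 2) = y⁻¹ * (1 + (t / y) ^ 2)⁻¹ := by
  have : t ^ 2 + y ^ 2 ≠ 0 := by positivity
  field_simp
  ring

theorem integrable_div_sq_add_sq (hy : y ≠ 0) : Integrable fun t : ℝ => y / (t ^ 2 + y ^ 2) := by
  simp only [div_sq_add_sq_eq hy]
  exact (integrable_inv_one_add_sq.comp_div hy).const_mul _

theorem integral_univ_div_sq_add_sq (hy : y ≠ 0) :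
    ∫ t : ℝ, y / (t ^ 2 + y ^ 2) = |y| / y * Real.pi := by
  simp only [div_sq_add_sq_eq hy]
  rw [integral_const_mul, Measure.integral_comp_div (fun t : ℝ => (1 + t ^ 2)⁻¹),
    integral_univ_inv_one_add_sq, smul_eq_mul]
  ring

end PoissonKernel

theorem ofReal_add_mul_I_inv_add_neg_inv (t : ℝ) {y : ℝ} (hy : y ≠ 0) :
    ((t + y * I : ℂ)⁻¹ + ((-t : ℝ) + y * I : ℂ)⁻¹) = -2 * I * (y / (t ^ 2 + y ^ 2) : ℝ) := by
  have h₁ : (t + y * I : ℂ) ≠ 0 := fun h => hy (by simpa using congrArg im h)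
  have h₂ : ((-t : ℝ) + y * I : ℂ) ≠ 0 := fun h => hy (by simpa using congrArg im h)
  have h₃ : (t ^ 2 + y ^ 2 : ℂ) ≠ 0 := by exact_mod_cast (by positivity : t ^ 2 + y ^ 2 ≠ 0)
  push_cast at h₂ ⊢
  field_simp
  linear_combination (2 * I * y ^ 3) * I_sq

theorem integrable_stripKernel {y : ℝ} (h₀ : y ≠ 0) (h₁ : y + Real.pi ≠ 0) :
    Integrable fun t : ℝ => stripKernel (t + y * I) := by
  obtain ⟨d, hd₀, hd⟩ : ∃ d > 0, d ≤ min 1 (min |y| |y + Real.pi|) :=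
    ⟨_, by positivity, le_rfl⟩
  obtain ⟨hd₁, hdy, hdy'⟩ : d ≤ 1 ∧ d ≤ |y| ∧ d ≤ |y + Real.pi| := by simpa using hd
  refine (integrable_inv_one_add_sq.const_mul (Real.pi / d ^ 2)).mono' ?_
    (Eventually.of_forall fun t => ?_)
  · refine Continuous.aestronglyMeasurable (continuous_iff_continuousAt.mpr fun t => ?_)
    exact (differentiableAt_stripKernel (s := t + y * I) (by simpa) (by simpa)).continuousAt.comp
      (f := fun t : ℝ => (t + y * I : ℂ)) (by fun_prop)
  · simpa using norm_stripKernel_le (s := t + y * I) hd₀ hd₁ (by simpa) (by simpa)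

-- Averaging over `t ↦ -t` leaves a difference of two Poisson kernels.
theorem integral_stripKernel {y : ℝ} (h₀ : y ≠ 0) (h₁ : y + Real.pi ≠ 0) :
    ∫ t : ℝ, stripKernel (t + y * I) =
      Real.pi * I * ((|y + Real.pi| / (y + Real.pi) - |y| / y : ℝ) : ℂ) := by
  have hsymm : ∀ t : ℝ, stripKernel (t + y * I) + stripKernel ((-t : ℝ) + y * I) =
      2 * I * (((y + Real.pi) / (t ^ 2 + (y + Real.pi) ^ 2) - y / (t ^ 2 + y ^ 2) : ℝ) : ℂ) := by
    intro t
    have e₁ := ofReal_add_mul_I_inv_add_neg_inv t h₀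
    have e₂ := ofReal_add_mul_I_inv_add_neg_inv t h₁
    have hassoc : ∀ u : ℂ, u + y * I + Real.pi * I = u + ((y + Real.pi : ℝ) : ℂ) * I := fun u => by
      push_cast; ring
    rw [stripKernel, stripKernel, hassoc, hassoc, Complex.ofReal_sub]
    linear_combination e₁ - e₂
  have hint := integrable_stripKernel h₀ h₁
  have hdouble : 2 * ∫ t : ℝ, stripKernel (t + y * I) =
      2 * I * (((|y + Real.pi| / (y + Real.pi) - |y| / y) * Real.pi : ℝ) : ℂ) := by
    calc _ = (∫ t : ℝ, stripKernel (t + y * I)) + ∫ t : ℝ, stripKernel ((-t : ℝ) + y * I) := by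
          rw [integral_neg_eq_self (fun t : ℝ => stripKernel (t + y * I)), two_mul]
      _ = ∫ t : ℝ, 2 * I *
          (((y + Real.pi) / (t ^ 2 + (y + Real.pi) ^ 2) - y / (t ^ 2 + y ^ 2) : ℝ) : ℂ) := by
          rw [← integral_add hint hint.comp_neg]; simp only [hsymm]
      _ = _ := by
          rw [integral_const_mul, integral_complex_ofReal, integral_sub
            (integrable_div_sq_add_sq h₁) (integrable_div_sq_add_sq h₀),
            integral_univ_div_sq_add_sq h₀, integral_univ_div_sq_add_sq h₁, sub_mul]
  push_cast at hdouble ⊢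
  linear_combination hdouble / 2

theorem integral_horizontal_line_eq {h : ℂ → ℂ} {a b C : ℝ}
    (hd : DifferentiableOn ℂ h {s | s.im ∈ Set.uIcc a b})
    (ha : Integrable fun t : ℝ => h (t + a * I)) (hb : Integrable fun t : ℝ => h (t + b * I))
    (hC : ∀ s : ℂ, s.im ∈ Set.uIcc a b → ‖h s‖ * |s.re| ≤ C) :
    ∫ t : ℝ, h (t + a * I) = ∫ t : ℝ, h (t + b * I) := by
  let side : ℝ → ℂ := fun R => ∫ y in a..b, h (R + y * I)
  have hside : ∀ R : ℝ, R ≠ 0 → ‖side R‖ ≤ C / |R| * |b - a| := fun R hR =>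
    intervalIntegral.norm_integral_le_of_norm_le_const fun y hy => by
      rw [le_div_iff₀ (abs_pos.mpr hR)]
      simpa using hC (R + y * I) (by simpa using Set.uIoc_subset_uIcc hy)
  have hrect : ∀ R : ℝ, (∫ t in -R..R, h (t + a * I)) - (∫ t in -R..R, h (t + b * I)) =
      I * side (-R) - I * side R := fun R => by
    have := integral_boundary_rect_eq_zero_of_differentiableOn h (-R + a * I) (R + b * I)
      (hd.mono fun s hs => by simpa using hs.2)
    simp only [add_re, neg_re, ofReal_re, mul_re, I_re, mul_zero, ofReal_im, I_im, mul_one,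
      sub_self, add_zero, add_im, neg_im, mul_im, zero_add, neg_zero, smul_eq_mul] at this
    linear_combination this
  have hlim := (intervalIntegral_tendsto_integral ha tendsto_neg_atTop_atBot tendsto_id).sub
    (intervalIntegral_tendsto_integral hb tendsto_neg_atTop_atBot tendsto_id)
  have hzero : Tendsto (fun R : ℝ => I * side (-R) - I * side R) atTop (𝓝 0) := by
    refine squeeze_zero_norm' (a := fun R => 2 * (C * |b - a|) / R) ?_
      (tendsto_const_nhds.div_atTop tendsto_id)
    filter_upwards [eventually_gt_atTop 0] with R hR
    have h₁ := hside R hR.ne'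
    have h₂ := hside (-R) (neg_ne_zero.mpr hR.ne')
    rw [abs_neg] at h₂
    rw [abs_of_pos hR] at h₁ h₂
    calc _ ≤ ‖side (-R)‖ + ‖side R‖ := (norm_sub_le _ _).trans_eq (by simp)
      _ ≤ C / R * |b - a| + C / R * |b - a| := add_le_add h₂ h₁
      _ = _ := by ring
  refine sub_eq_zero.mp (tendsto_nhds_unique hlim (hzero.congr fun R => (hrect R).symm))

theorem norm_dslope_le_of_bounded {f : ℂ → ℂ} {U : Set ℂ} {v η : ℂ} {δ M : ℝ} (hδ : 0 < δ)
    (hU : Metric.ball v δ ⊆ U) (hf : DifferentiableOn ℂ f (Metric.ball v δ))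
    (hM : ∀ ξ ∈ U, ‖f ξ‖ ≤ M) (hη : η ∈ U) : ‖dslope f v η‖ ≤ 2 * M / δ := by
  have hdist : ∀ ξ ∈ U, ‖f ξ - f v‖ ≤ 2 * M := fun ξ hξ =>
    (norm_sub_le _ _).trans (by linarith [hM ξ hξ, hM v (hU (Metric.mem_ball_self hδ))])
  by_cases hnear : η ∈ Metric.ball v δ
  · exact norm_dslope_le_div_of_mapsTo_ball hf
      (fun ξ hξ => mem_closedBall_iff_norm.mpr (hdist ξ (hU hξ))) hnear
  · have hfar : δ ≤ ‖η - v‖ := not_lt.mp fun h => hnear (mem_ball_iff_norm.mpr h)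
    have hne : η ≠ v := sub_ne_zero.mp (norm_pos_iff.mp (hδ.trans_le hfar))
    rw [dslope_of_ne _ hne, slope_def_field, norm_div]
    exact div_le_div₀ ((norm_nonneg _).trans (hdist η hη)) (hdist η hη) hδ hfar

theorem ofReal_add_mul_I_sub (t c : ℝ) (v : ℂ) :
    (t + c * I - v : ℂ) = ((t - v.re : ℝ) : ℂ) + ((c - v.im : ℝ) : ℂ) * I := by
  apply Complex.ext <;> simp

variable {f : ℂ → ℂ} {v : ℂ} {c M : ℝ}

theorem integrable_mul_stripKernel (hf : Continuous fun t : ℝ => f (t + c * I))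
    (hM : ∀ t : ℝ, ‖f (t + c * I)‖ ≤ M) (h₀ : c - v.im ≠ 0) (h₁ : c - v.im + Real.pi ≠ 0) :
    Integrable fun t : ℝ => f (t + c * I) * stripKernel (t + c * I - v) := by
  refine Integrable.bdd_mul ?_ hf.aestronglyMeasurable (Eventually.of_forall hM)
  simp only [ofReal_add_mul_I_sub]
  exact (integrable_stripKernel h₀ h₁).comp_sub_right v.re

theorem norm_cauchyLine_le {d : ℝ} (hM : ∀ t : ℝ, ‖f (t + c * I)‖ ≤ M) (hd₀ : 0 < d) (hd₁ : d ≤ 1)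
    (h₀ : d ≤ |c - v.im|) (h₁ : d ≤ |c - v.im + Real.pi|) :
    ‖cauchyLine c f v‖ ≤ Real.pi / (2 * d ^ 2) * M := by
  have hbound : ∀ t : ℝ, ‖f (t + c * I) * stripKernel (t + c * I - v)‖ ≤
      M * (Real.pi / d ^ 2) * (1 + (t - v.re) ^ 2)⁻¹ := fun t => by
    have hK := norm_stripKernel_le (s := t + c * I - v) hd₀ hd₁ (by simpa) (by simpa)
    rw [norm_mul, mul_assoc]
    exact mul_le_mul (hM t) (by simpa using hK) (norm_nonneg _) ((norm_nonneg _).trans (hM t))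
  have hint := norm_integral_le_of_norm_le (integrable_stripKernel_bound _ _)
    (Eventually.of_forall hbound)
  rw [integral_stripKernel_bound] at hint
  calc ‖cauchyLine c f v‖ ≤ (2 * Real.pi)⁻¹ * (M * (Real.pi / d ^ 2) * Real.pi) := by
        rw [cauchyLine, norm_mul]
        gcongr
        simp [abs_of_pos Real.pi_pos]
    _ = _ := by field_simp

/-- The quotient `(f (v + s) - f v) * stripKernel s`, continued holomorphically across `s = 0`. -/
noncomputable def stripQuotient (f : ℂ → ℂ) (v s : ℂ) : ℂ :=
  dslope f v (v + s) * (Real.pi * I / (s + Real.pi * I))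

theorem stripQuotient_eq {s : ℂ} (h₀ : s.im ≠ 0) (h₁ : s.im + Real.pi ≠ 0) :
    stripQuotient f v s = (f (v + s) - f v) * stripKernel s := by
  have hs₀ : s ≠ 0 := fun e => h₀ (by simp [e])
  have hs₁ : s + Real.pi * I ≠ 0 := fun e => h₁ (by rw [← im_add_pi_mul_I, e, zero_im])
  rw [stripQuotient, dslope_of_ne _ (by simpa), slope_def_field, stripKernel_eq_div hs₀ hs₁,
    add_sub_cancel_left]
  ring

theorem integrable_stripQuotient_and_integral_eq (hf : Continuous fun t : ℝ => f (t + c * I))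
    (hM : ∀ t : ℝ, ‖f (t + c * I)‖ ≤ M) (h₀ : c - v.im ≠ 0) (h₁ : c - v.im + Real.pi ≠ 0) :
    Integrable (fun t : ℝ => stripQuotient f v (t + (c - v.im : ℝ) * I)) ∧
      ∫ t : ℝ, stripQuotient f v (t + (c - v.im : ℝ) * I) =
        (∫ t : ℝ, f (t + c * I) * stripKernel (t + c * I - v)) -
          f v * ∫ t : ℝ, stripKernel (t + (c - v.im : ℝ) * I) := by
  have hpoint : ∀ t : ℝ, stripQuotient f v (t + (c - v.im : ℝ) * I) =
      f ((t + v.re : ℝ) + c * I) * stripKernel ((t + v.re : ℝ) + c * I - v) -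
        f v * stripKernel (t + (c - v.im : ℝ) * I) := fun t => by
    have hvs : ((t + v.re : ℝ) + c * I : ℂ) = v + (t + (c - v.im : ℝ) * I) := by
      apply Complex.ext <;> simp [add_comm]
    rw [stripQuotient_eq (by simpa) (by simpa), hvs, add_sub_cancel_left, sub_mul]
  have hfK := (integrable_mul_stripKernel hf hM h₀ h₁).comp_add_right v.re
  have hK := (integrable_stripKernel h₀ h₁).const_mul (f v)
  simp only [hpoint]
  refine ⟨hfK.sub hK, ?_⟩
  rw [integral_sub hfK hK, integral_const_mul,
    integral_add_right_eq_self fun t : ℝ => f (t + c * I) * stripKernel (t + c * I - v)]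

theorem integral_stripQuotient_of_neg (h₀ : c - v.im < 0) (h₁ : 0 < c - v.im + Real.pi)
    (hf : Continuous fun t : ℝ => f (t + c * I)) (hM : ∀ t : ℝ, ‖f (t + c * I)‖ ≤ M) :
    ∫ t : ℝ, stripQuotient f v (t + (c - v.im : ℝ) * I) =
      2 * Real.pi * I * (cauchyLine c f v - f v) := by
  rw [(integrable_stripQuotient_and_integral_eq hf hM h₀.ne h₁.ne').2,
    integral_stripKernel h₀.ne h₁.ne', abs_of_pos h₁, abs_of_neg h₀, div_self h₁.ne', neg_div,
    div_self h₀.ne, cauchyLine]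
  have := Real.pi_pos.ne'
  push_cast
  field_simp [I_ne_zero]
  ring

theorem integral_stripQuotient_of_pos (h₀ : 0 < c - v.im)
    (hf : Continuous fun t : ℝ => f (t + c * I)) (hM : ∀ t : ℝ, ‖f (t + c * I)‖ ≤ M) :
    ∫ t : ℝ, stripQuotient f v (t + (c - v.im : ℝ) * I) = 2 * Real.pi * I * cauchyLine c f v := by
  have h₁ : 0 < c - v.im + Real.pi := add_pos h₀ Real.pi_pos
  rw [(integrable_stripQuotient_and_integral_eq hf hM h₀.ne' h₁.ne').2,
    integral_stripKernel h₀.ne' h₁.ne', abs_of_pos h₁, abs_of_pos h₀, div_self h₁.ne',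
    div_self h₀.ne', cauchyLine]
  have := Real.pi_pos.ne'
  field_simp [I_ne_zero]
  simp

theorem norm_stripQuotient_mul_abs_re_le {s : ℂ} {C : ℝ}
    (hC : ‖dslope f v (v + s)‖ ≤ C) : ‖stripQuotient f v s‖ * |s.re| ≤ C * Real.pi := by
  have hre : |s.re| ≤ ‖s + Real.pi * I‖ := by simpa using abs_re_le_norm (s + Real.pi * I)
  calc ‖stripQuotient f v s‖ * |s.re|
      = ‖dslope f v (v + s)‖ * (Real.pi * (|s.re| / ‖s + Real.pi * I‖)) := by
        simp only [stripQuotient, norm_mul, norm_div, norm_real, norm_I,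
          Real.norm_of_nonneg Real.pi_pos.le]
        ring
    _ ≤ C * (Real.pi * 1) := by
        gcongr
        exacts [(norm_nonneg _).trans hC, div_le_one_of_le₀ hre (norm_nonneg _)]
    _ = C * Real.pi := by rw [mul_one]

theorem differentiableOn_stripQuotient {U S : Set ℂ} (hf : DifferentiableOn ℂ f U) (hU : U ∈ 𝓝 v)
    (hS : ∀ s ∈ S, v + s ∈ U ∧ s.im + Real.pi ≠ 0) :
    DifferentiableOn ℂ (stripQuotient f v) S := by
  refine DifferentiableOn.fun_mul (((differentiableOn_dslope hU).mpr hf).comp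
    (differentiableOn_id.const_add v) fun s hs => (hS s hs).1) ?_
  refine (differentiableOn_const _).fun_div (by fun_prop) fun s hs e => (hS s hs).2 ?_
  rw [← im_add_pi_mul_I, e, zero_im]

theorem cauchyLine_sub_cauchyLine {a b c₁ c₂ : ℝ}
    (hf : DifferentiableOn ℂ f {η | η.im ∈ Set.Ioo a b}) (hM : ∀ η, η.im ∈ Set.Ioo a b → ‖f η‖ ≤ M)
    (ha : a < c₁) (h₁ : c₁ < v.im) (h₂ : v.im < c₂) (hb : c₂ < b) (hπ : v.im < c₁ + Real.pi) :
    cauchyLine c₁ f v - cauchyLine c₂ f v = f v := by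
  have hnhds : {η : ℂ | η.im ∈ Set.Ioo a b} ∈ 𝓝 v :=
    (isOpen_Ioo.preimage continuous_im).mem_nhds ⟨ha.trans h₁, h₂.trans hb⟩
  obtain ⟨δ, hδ, hball⟩ := Metric.mem_nhds_iff.mp hnhds
  have hc₁ : c₁ ∈ Set.Ioo a b := ⟨ha, by linarith⟩
  have hc₂ : c₂ ∈ Set.Ioo a b := ⟨by linarith, hb⟩
  have hline : ∀ {c : ℝ}, c ∈ Set.Ioo a b → (Continuous fun t : ℝ => f (t + c * I)) ∧
      ∀ t : ℝ, ‖f (t + c * I)‖ ≤ M := fun hc =>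
    ⟨hf.continuousOn.comp_continuous (by fun_prop) fun t => by simpa using hc,
      fun t => hM _ (by simpa using hc)⟩
  have hstrip : ∀ s : ℂ, s.im ∈ Set.uIcc (c₁ - v.im) (c₂ - v.im) →
      (v + s).im ∈ Set.Ioo a b ∧ 0 < s.im + Real.pi := fun s hs => by
    rw [Set.uIcc_of_le (by linarith)] at hs
    rw [add_im]
    exact ⟨⟨by linarith [hs.1], by linarith [hs.2]⟩, by linarith [hs.1]⟩
  have hy₁ : c₁ - v.im < 0 := by linarith
  have hy₁' : 0 < c₁ - v.im + Real.pi := by linarith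
  have hy₂ : 0 < c₂ - v.im := by linarith
  have hshift := integral_horizontal_line_eq (C := 2 * M / δ * Real.pi)
    (differentiableOn_stripQuotient hf hnhds fun s hs => (hstrip s hs).imp_right ne_of_gt)
    (integrable_stripQuotient_and_integral_eq (hline hc₁).1 (hline hc₁).2 hy₁.ne hy₁'.ne').1
    (integrable_stripQuotient_and_integral_eq (hline hc₂).1 (hline hc₂).2 hy₂.ne'
      (add_pos hy₂ Real.pi_pos).ne').1
    fun s hs => norm_stripQuotient_mul_abs_re_le
      (norm_dslope_le_of_bounded hδ hball (hf.mono hball) hM (hstrip s hs).1)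
  rw [integral_stripQuotient_of_neg hy₁ hy₁' (hline hc₁).1 (hline hc₁).2,
    integral_stripQuotient_of_pos hy₂ (hline hc₂).1 (hline hc₂).2] at hshift
  linear_combination mul_left_cancel₀ two_pi_I_ne_zero hshift

end StripCauchyIntegral

section StripExtension

open Complex MeasureTheory

theorem inv_one_add_sq_le_of_abs_sub_le {a b t : ℝ} (h : |a - b| ≤ 1) :
    (1 + (t - a) ^ 2)⁻¹ ≤ 3 * (1 + (t - b) ^ 2)⁻¹ := by
  rw [← div_eq_mul_inv, inv_le_comm₀ (by positivity) (by positivity), inv_div,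
    div_le_iff₀ (by norm_num)]
  nlinarith [sq_nonneg (t - a - (a - b)), (sq_le_one_iff_abs_le_one _).mpr h]

theorem le_abs_of_two_mul_le_abs {d y y₀ : ℝ} (h₀ : 2 * d ≤ |y₀|) (h : |y₀ - y| ≤ d) :
    d ≤ |y| := by
  linarith [abs_sub_abs_le_abs_sub y₀ y]

theorem norm_stripKernel_sub_le {v v₀ : ℂ} {d : ℝ} (t c : ℝ) (hd₀ : 0 < d) (hd₁ : d ≤ 1)
    (hv : ‖v - v₀‖ ≤ d) (h₀ : 2 * d ≤ |c - v₀.im|) (h₁ : 2 * d ≤ |c - v₀.im + Real.pi|) :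
    ‖stripKernel (t + c * I - v)‖ ≤ Real.pi / d ^ 2 * (3 * (1 + (t - v₀.re) ^ 2)⁻¹) := by
  have him : |v.im - v₀.im| ≤ d := (abs_im_le_norm (v - v₀)).trans hv
  have hre : |v.re - v₀.re| ≤ 1 := (abs_re_le_norm (v - v₀)).trans (hv.trans hd₁)
  have hK := norm_stripKernel_le (s := t + c * I - v) hd₀ hd₁
    (by simpa using le_abs_of_two_mul_le_abs h₀ (by simpa using him))
    (by simpa using le_abs_of_two_mul_le_abs h₁ (by simpa using him))
  refine hK.trans ?_
  gcongr
  simpa using inv_one_add_sq_le_of_abs_sub_le (t := t) hre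

theorem differentiableAt_stripKernel_sub {v v₀ : ℂ} {d : ℝ} (t c : ℝ) (hd₀ : 0 < d)
    (hv : ‖v - v₀‖ ≤ d) (h₀ : 2 * d ≤ |c - v₀.im|) (h₁ : 2 * d ≤ |c - v₀.im + Real.pi|) :
    DifferentiableAt ℂ stripKernel (t + c * I - v) := by
  have him : |v.im - v₀.im| ≤ d := (abs_im_le_norm (v - v₀)).trans hv
  have hy₀ := le_abs_of_two_mul_le_abs (y := c - v.im) h₀ (by simpa using him)
  have hy₁ := le_abs_of_two_mul_le_abs (y := c - v.im + Real.pi) h₁ (by simpa using him)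
  exact differentiableAt_stripKernel (by simpa using abs_pos.mp (hd₀.trans_le hy₀))
    (by simpa using abs_pos.mp (hd₀.trans_le hy₁))

section Bounds

variable {E : Type*} {V : Set E} {f : ℂ × E → ℂ} {M : ℝ} {q : ℂ × E}

/-- `cauchyLine` in the first variable of a function of two variables. -/
noncomputable def cauchyLineFst (c : ℝ) (f : ℂ × E → ℂ) (q : ℂ × E) : ℂ :=
  cauchyLine c (fun η => f (η, q.2)) q.1

/-- An extension to the strip `0 < Im v < π` of a bounded holomorphic function `f` given on
`0 < Im v < π / 2`: the part of `f` without singularities at the upper boundary, normalised to agree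
with `f` at `v = 0`. -/
noncomputable def stripExtension (f : ℂ × E → ℂ) (q : ℂ × E) : ℂ :=
  (if q.1.im < 3 / 4 then f q + cauchyLineFst 1 f q else cauchyLineFst (1 / 2) f q) -
    cauchyLineFst 1 f (0, q.2)

theorem norm_cauchyLineFst_le {c : ℝ}
    (hM : ∀ q ∈ {η : ℂ | η.im ∈ Set.Ioo 0 (Real.pi / 2)} ×ˢ V, ‖f q‖ ≤ M)
    (hc : c ∈ Set.Ioo 0 (Real.pi / 2)) (hq : q.2 ∈ V) (h₀ : 1 / 4 ≤ |c - q.1.im|)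
    (h₁ : 1 / 4 ≤ |c - q.1.im + Real.pi|) : ‖cauchyLineFst c f q‖ ≤ 26 * M := by
  have hline : ∀ t : ℝ, ‖f (t + c * I, q.2)‖ ≤ M := fun t => hM _ ⟨by simpa using hc, hq⟩
  refine (norm_cauchyLine_le (f := fun η => f (η, q.2)) hline (by norm_num) (by norm_num) h₀
    h₁).trans ?_
  gcongr
  · exact (norm_nonneg _).trans (hline 0)
  · rw [div_le_iff₀ (by norm_num)]; linarith [Real.pi_lt_d2]

theorem norm_stripExtension_le
    (hM : ∀ q ∈ {η : ℂ | η.im ∈ Set.Ioo 0 (Real.pi / 2)} ×ˢ V, ‖f q‖ ≤ M)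
    (hq : q ∈ {η : ℂ | η.im ∈ Set.Ioo 0 Real.pi} ×ˢ V) : ‖stripExtension f q‖ ≤ 53 * M := by
  obtain ⟨⟨hq₀, hqπ⟩, hqV⟩ := hq
  have hπ := Real.pi_gt_three
  have h₀ : ‖cauchyLineFst 1 f (0, q.2)‖ ≤ 26 * M :=
    norm_cauchyLineFst_le hM ⟨by norm_num, by linarith⟩ hqV (by norm_num)
      (le_abs.mpr (.inl (by simp; linarith)))
  refine (norm_sub_le _ _).trans ?_
  split_ifs with hq
  · have hfq := hM q ⟨⟨hq₀, by linarith⟩, hqV⟩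
    have hU := norm_cauchyLineFst_le (c := 1) hM ⟨by norm_num, by linarith⟩ hqV
      (le_abs.mpr (.inl (by linarith))) (le_abs.mpr (.inl (by linarith)))
    linarith [norm_add_le (f q) (cauchyLineFst 1 f q)]
  · have hU := norm_cauchyLineFst_le (c := 1 / 2) hM ⟨by norm_num, by linarith⟩ hqV
      (le_abs.mpr (.inr (by linarith))) (le_abs.mpr (.inl (by linarith)))
    linarith [norm_nonneg (cauchyLineFst (1 / 2) f q)]

end Bounds

variable {E : Type*} [NormedAddCommGroup E] [NormedSpace ℂ E] {V : Set E} {f : ℂ × E → ℂ} {M : ℝ}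
  {q : ℂ × E}

theorem differentiableAt_cauchyLine {a b c : ℝ} {p : ℂ × E} (hV : IsOpen V)
    (hf : DifferentiableOn ℂ f ({η | η.im ∈ Set.Ioo a b} ×ˢ V))
    (hM : ∀ q ∈ {η : ℂ | η.im ∈ Set.Ioo a b} ×ˢ V, ‖f q‖ ≤ M) (hc : c ∈ Set.Ioo a b)
    (hp : p.2 ∈ V) (h₀ : c - p.1.im ≠ 0) (h₁ : c - p.1.im + Real.pi ≠ 0) :
    DifferentiableAt ℂ (fun q : ℂ × E => cauchyLine c (fun η => f (η, q.2)) q.1) p := by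
  obtain ⟨r, hr, hrV⟩ := Metric.isOpen_iff.mp hV p.2 hp
  obtain ⟨d, hd₀, hd⟩ : ∃ d > 0, d ≤ min (min 1 r) (min (|c - p.1.im| / 2)
    (|c - p.1.im + Real.pi| / 2)) := ⟨_, by positivity, le_rfl⟩
  obtain ⟨⟨hd₁, hdr⟩, hd₂, hd₃⟩ := by simpa only [le_min_iff] using hd
  have hline : ∀ t : ℝ, (t + c * I : ℂ) ∈ {η : ℂ | η.im ∈ Set.Ioo a b} := fun t => by simpa using hc
  have hball : ∀ q ∈ Metric.ball p d, ‖q.1 - p.1‖ < d ∧ q.2 ∈ V := fun q hq =>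
    ⟨(norm_fst_le (q - p)).trans_lt (mem_ball_iff_norm.mp hq), hrV (mem_ball_iff_norm.mpr
      ((norm_snd_le (q - p)).trans_lt ((mem_ball_iff_norm.mp hq).trans_le hdr)))⟩
  have hfd : ∀ q ∈ Metric.ball p d, ∀ t : ℝ, DifferentiableAt ℂ f (t + c * I, q.2) := fun q hq t =>
    hf.differentiableAt (((isOpen_Ioo.preimage continuous_im).prod hV).mem_nhds
      ⟨hline t, (hball q hq).2⟩)
  have hKd : ∀ q ∈ Metric.ball p d, ∀ t : ℝ,
      DifferentiableAt ℂ stripKernel (t + c * I - q.1) := fun q hq t =>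
    differentiableAt_stripKernel_sub t c hd₀ (hball q hq).1.le (by linarith) (by linarith)
  refine DifferentiableAt.const_mul (differentiableAt_integral_of_dominated hd₀
    (bound := fun t => M * (Real.pi / d ^ 2 * (3 * (1 + (t - p.1.re) ^ 2)⁻¹)))
    (fun q hq => ?_) (Eventually.of_forall fun t q hq => ?_)
    (Eventually.of_forall fun t q hq => ?_) ?_) _
  · refine (continuous_iff_continuousAt.mpr fun t => ContinuousAt.mul ?_ ?_).aestronglyMeasurable
    · exact (hfd q hq t).continuousAt.comp (f := fun t : ℝ => (t + c * I, q.2)) (by fun_prop)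
    · exact (hKd q hq t).continuousAt.comp (f := fun t : ℝ => t + c * I - q.1) (by fun_prop)
  · refine (DifferentiableAt.fun_mul ?_ ?_).differentiableWithinAt
    · exact (hfd q hq t).comp q (f := fun q : ℂ × E => (t + c * I, q.2)) (by fun_prop)
    · exact (hKd q hq t).comp q (f := fun q : ℂ × E => t + c * I - q.1) (by fun_prop)
  · have hfq := hM (t + c * I, q.2) ⟨hline t, (hball q hq).2⟩
    rw [norm_mul]
    exact mul_le_mul hfq (norm_stripKernel_sub_le t c hd₀ hd₁ (hball q hq).1.le (by linarith)
      (by linarith)) (norm_nonneg _) ((norm_nonneg _).trans hfq)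
  · exact ((integrable_stripKernel_bound 3 p.1.re).const_mul _).const_mul _

theorem stripExtension_eq_of_im_lt_one
    (hf : DifferentiableOn ℂ f ({η | η.im ∈ Set.Ioo 0 (Real.pi / 2)} ×ˢ V))
    (hM : ∀ q ∈ {η : ℂ | η.im ∈ Set.Ioo 0 (Real.pi / 2)} ×ˢ V, ‖f q‖ ≤ M) (hq : q.2 ∈ V)
    (h₁ : q.1.im < 1) :
    stripExtension f q = f q + cauchyLineFst 1 f q - cauchyLineFst 1 f (0, q.2) := by
  rw [stripExtension, ite_eq_left_iff.mpr fun hlow => ?_]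
  have hπ := Real.pi_gt_three
  rw [← sub_eq_iff_eq_add]
  exact cauchyLine_sub_cauchyLine (hf.comp (f := fun η => (η, q.2)) (by fun_prop)
    fun η hη => ⟨hη, hq⟩) (fun η hη => hM (η, q.2) ⟨hη, hq⟩) (by norm_num) (by linarith) h₁
    (by linarith) (by linarith)

theorem differentiableOn_stripExtension (hV : IsOpen V)
    (hf : DifferentiableOn ℂ f ({η | η.im ∈ Set.Ioo 0 (Real.pi / 2)} ×ˢ V))
    (hM : ∀ q ∈ {η : ℂ | η.im ∈ Set.Ioo 0 (Real.pi / 2)} ×ˢ V, ‖f q‖ ≤ M) :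
    DifferentiableOn ℂ (stripExtension f) ({η | η.im ∈ Set.Ioo 0 Real.pi} ×ˢ V) := by
  rintro q ⟨⟨hq₀, hqπ⟩, hqV⟩
  have hπ := Real.pi_gt_three
  have him : Continuous fun q : ℂ × E => q.1.im := continuous_im.comp continuous_fst
  have hline : ∀ {c : ℝ} {q : ℂ × E}, c ∈ Set.Ioo 0 (Real.pi / 2) → q.2 ∈ V →
      c - q.1.im ≠ 0 → c - q.1.im + Real.pi ≠ 0 → DifferentiableAt ℂ (cauchyLineFst c f) q :=
    fun hc hqV h₀ h₁ => differentiableAt_cauchyLine hV hf hM hc hqV h₀ h₁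
  have h₀ : DifferentiableAt ℂ (fun q : ℂ × E => cauchyLineFst 1 f (0, q.2)) q :=
    DifferentiableAt.comp q (f := fun q : ℂ × E => ((0 : ℂ), q.2))
      (hline ⟨by norm_num, by linarith⟩ hqV (by simp) (by simp; linarith)) (by fun_prop)
  refine DifferentiableAt.differentiableWithinAt ?_
  rcases lt_or_ge q.1.im 1 with hq | hq
  · have hU := hline (c := 1) (q := q) ⟨by norm_num, by linarith⟩ hqV (by linarith) (by linarith)
    have hfq : DifferentiableAt ℂ f q := hf.differentiableAt
      (((isOpen_Ioo.preimage continuous_im).prod hV).mem_nhds ⟨⟨hq₀, by linarith⟩, hqV⟩)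
    refine ((hfq.fun_add hU).fun_sub h₀).congr_of_eventuallyEq ?_
    filter_upwards [him.tendsto q |>.eventually_lt_const hq,
      continuous_snd.tendsto q |>.eventually_mem (hV.mem_nhds hqV)] with q' hq' hqV'
    exact stripExtension_eq_of_im_lt_one hf hM hqV' hq'
  · have hU := hline (c := 1 / 2) (q := q) ⟨by norm_num, by linarith⟩ hqV (by linarith)
      (by linarith)
    refine (hU.fun_sub h₀).congr_of_eventuallyEq ?_
    filter_upwards [him.tendsto q |>.eventually_const_lt (show 3 / 4 < q.1.im by linarith)]
      with q' hq'
    rw [stripExtension, if_neg hq'.not_gt]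

theorem norm_stripExtension_sub_le (hV : IsOpen V)
    (hf : DifferentiableOn ℂ f ({η | η.im ∈ Set.Ioo 0 (Real.pi / 2)} ×ˢ V))
    (hM : ∀ q ∈ {η : ℂ | η.im ∈ Set.Ioo 0 (Real.pi / 2)} ×ˢ V, ‖f q‖ ≤ M) (hqV : q.2 ∈ V)
    (hq : ‖q.1‖ < 3 / 4) : ‖stripExtension f q - f q‖ ≤ 70 * M * ‖q.1‖ := by
  have hπ := Real.pi_gt_three
  have hmem : (1 : ℝ) ∈ Set.Ioo 0 (Real.pi / 2) := ⟨by norm_num, by linarith⟩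
  have him : ∀ v ∈ Metric.ball (0 : ℂ) (3 / 4), |v.im| < 3 / 4 := fun v hv =>
    (abs_im_le_norm v).trans_lt (mem_ball_zero_iff.mp hv)
  let U : ℂ → ℂ := fun v => cauchyLineFst 1 f (v, q.2)
  have hUd : DifferentiableOn ℂ U (Metric.ball 0 (3 / 4)) := fun v hv => by
    have := abs_lt.mp (him v hv)
    exact (DifferentiableAt.comp v (f := fun v : ℂ => (v, q.2))
      (differentiableAt_cauchyLine (p := (v, q.2)) hV hf hM hmem hqV (by simp; linarith)
        (by simp; linarith)) (by fun_prop)).differentiableWithinAt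
  have hU : ∀ v ∈ Metric.ball (0 : ℂ) (3 / 4), ‖U v‖ ≤ 26 * M := fun v hv => by
    have := abs_lt.mp (him v hv)
    exact norm_cauchyLineFst_le hM hmem hqV (le_abs.mpr (.inl (by simp; linarith)))
      (le_abs.mpr (.inl (by simp; linarith)))
  have hmaps : Set.MapsTo U (Metric.ball 0 (3 / 4)) (Metric.closedBall (U 0) (52 * M)) :=
    fun v hv => mem_closedBall_iff_norm.mpr <| (norm_sub_le _ _).trans <| by
      linarith [hU v hv, hU 0 (Metric.mem_ball_self (by norm_num))]
  have hq' : q.1 ∈ Metric.ball (0 : ℂ) (3 / 4) := mem_ball_zero_iff.mpr hq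
  have hM₀ : 0 ≤ M := by linarith [(norm_nonneg _).trans (hU q.1 hq')]
  rw [stripExtension_eq_of_im_lt_one hf hM hqV (by linarith [abs_lt.mp (him _ hq')]),
    add_sub_assoc, add_sub_cancel_left, ← dist_eq_norm]
  refine (Complex.dist_le_div_mul_dist_of_mapsTo_ball hUd hmaps hq').trans ?_
  rw [dist_zero_right]
  gcongr
  linarith

end StripExtension

section DiscExtension

open Complex

/-- The Möbius map of the unit disc onto the upper half-plane with `c ↦ ∞` and `1 ↦ 1`,
for `‖c‖ = 1` and `0 < Im c`. -/
noncomputable def discToHalfPlane (c z : ℂ) : ℂ := (1 - c * z) / (z - c)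

/-- The inverse of `discToHalfPlane c`. -/
noncomputable def halfPlaneToDisc (c u : ℂ) : ℂ := (1 + c * u) / (u + c)

variable {c z u v : ℂ}

theorem halfPlaneToDisc_discToHalfPlane (hc : c ^ 2 ≠ 1) (hz : z ≠ c) :
    halfPlaneToDisc c (discToHalfPlane c z) = z := by
  have hz' : z - c ≠ 0 := sub_ne_zero.mpr hz
  have hden : discToHalfPlane c z + c = (1 - c ^ 2) / (z - c) := by
    rw [discToHalfPlane]; field_simp; ring
  have hnum : 1 + c * discToHalfPlane c z = z * ((1 - c ^ 2) / (z - c)) := by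
    rw [discToHalfPlane]; field_simp; ring
  rw [halfPlaneToDisc, hden, hnum,
    mul_div_cancel_right₀ _ (div_ne_zero (sub_ne_zero.mpr hc.symm) hz')]

theorem discToHalfPlane_one (hc : c ≠ 1) : discToHalfPlane c 1 = 1 := by
  rw [discToHalfPlane, mul_one, div_self (sub_ne_zero.mpr hc.symm)]

theorem re_sq_add_im_sq_eq_one (hc : ‖c‖ = 1) : c.re ^ 2 + c.im ^ 2 = 1 := by
  rw [← one_pow 2, ← hc, Complex.sq_norm, normSq_apply]
  ring

theorem im_discToHalfPlane (hc : ‖c‖ = 1) (z : ℂ) :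
    (discToHalfPlane c z).im = c.im * (1 - ‖z‖ ^ 2) / ‖z - c‖ ^ 2 := by
  have hc' := re_sq_add_im_sq_eq_one hc
  rw [discToHalfPlane, div_im, ← Complex.sq_norm, ← sub_div, Complex.sq_norm z, normSq_apply]
  congr 1
  simp only [sub_re, sub_im, mul_re, mul_im, one_re, one_im]
  linear_combination (z.im) * hc'

theorem add_ne_zero_of_im_pos (hu : 0 < u.im) (hv : 0 < v.im) : u + v ≠ 0 := fun h => by
  simpa [h] using (add_pos hu hv).trans_eq (add_im u v).symm

theorem norm_halfPlaneToDisc_lt_one (hc : ‖c‖ = 1) (him : 0 < c.im) (hu : 0 < u.im) :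
    ‖halfPlaneToDisc c u‖ < 1 := by
  have hc' := re_sq_add_im_sq_eq_one hc
  have hpos : 0 < ‖u + c‖ := norm_pos_iff.mpr (add_ne_zero_of_im_pos hu him)
  rw [halfPlaneToDisc, norm_div, div_lt_one hpos, ← pow_lt_pow_iff_left₀ (norm_nonneg _) hpos.le
    two_ne_zero, Complex.sq_norm, Complex.sq_norm, normSq_apply, normSq_apply]
  simp only [add_re, add_im, mul_re, mul_im, one_re, one_im]
  have : (c.re ^ 2 + c.im ^ 2) * (u.re ^ 2 + u.im ^ 2) = u.re ^ 2 + u.im ^ 2 := by rw [hc', one_mul]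
  linarith [mul_pos him hu]

theorem norm_halfPlaneToDisc_sub_one_le (hre : 0 ≤ c.re) (him : 0 < c.im) (hc : ‖c‖ = 1)
    (hur : 0 ≤ u.re) (hui : 0 < u.im) : ‖halfPlaneToDisc c u - 1‖ ≤ ‖c - 1‖ := by
  have hc' := re_sq_add_im_sq_eq_one hc
  have hpos : 0 < ‖u + c‖ := norm_pos_iff.mpr (add_ne_zero_of_im_pos hui him)
  have hle : ‖u - 1‖ ≤ ‖u + c‖ := by
    rw [← pow_le_pow_iff_left₀ (norm_nonneg _) hpos.le two_ne_zero, Complex.sq_norm,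
      Complex.sq_norm, normSq_apply, normSq_apply]
    simp only [add_re, add_im, sub_re, sub_im, one_re, one_im]
    nlinarith [mul_nonneg him.le hui.le, mul_nonneg hre hur]
  have hdiff : halfPlaneToDisc c u - 1 = (c - 1) * ((u - 1) / (u + c)) := by
    have := norm_pos_iff.mp hpos
    rw [halfPlaneToDisc]; field_simp; ring
  rw [hdiff, norm_mul, norm_div]
  exact mul_le_of_le_one_right (norm_nonneg _) (div_le_one_of_le₀ hle hpos.le)

theorem exists_norm_eq_one_norm_sub_one_lt {ε : ℝ} (hε : 0 < ε) :
    ∃ c : ℂ, ‖c‖ = 1 ∧ 0 ≤ c.re ∧ 0 < c.im ∧ ‖c - 1‖ < ε := by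
  obtain ⟨α, hα₀, hα⟩ := exists_between (lt_min hε Real.pi_div_two_pos)
  obtain ⟨hαε, hαπ⟩ := lt_min_iff.mp hα
  refine ⟨exp (I * α), ?_, ?_, ?_, ?_⟩
  · rw [mul_comm, norm_exp_ofReal_mul_I]
  · rw [mul_comm, exp_ofReal_mul_I_re]
    exact Real.cos_nonneg_of_neg_pi_div_two_le_of_le (by linarith) hαπ.le
  · rw [mul_comm, exp_ofReal_mul_I_im]
    exact Real.sin_pos_of_pos_of_lt_pi hα₀ (by linarith)
  · exact (Real.norm_exp_I_mul_ofReal_sub_one_le).trans_lt (by rwa [Real.norm_of_nonneg hα₀.le])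

theorem exists_min_one_norm_le_mul_norm_sub {E F : Type*} [NormedAddCommGroup E]
    [NormedSpace ℂ E] [NormedAddCommGroup F] [NormedSpace ℂ F] {f : E → F} {x : E}
    (hf : DifferentiableAt ℂ f x) (hx : f x = 0) :
    ∃ C ≥ 0, ∀ y, min 1 ‖f y‖ ≤ C * ‖y - x‖ := by
  have hO : f =O[𝓝 x] fun y => y - x := by simpa [hx] using hf.isBigO_sub
  obtain ⟨C, hC⟩ := hO.bound
  obtain ⟨ρ, hρ, hball⟩ := Metric.eventually_nhds_iff.mp hC
  refine ⟨max C ρ⁻¹, le_max_of_le_right (by positivity), fun y => ?_⟩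
  rcases lt_or_ge ‖y - x‖ ρ with hy | hy
  · refine (min_le_right _ _).trans ((hball (by rwa [dist_eq_norm])).trans ?_)
    gcongr
    exact le_max_left _ _
  · calc min 1 ‖f y‖ ≤ ρ⁻¹ * ρ := by rw [inv_mul_cancel₀ hρ.ne']; exact min_le_left _ _
      _ ≤ max C ρ⁻¹ * ‖y - x‖ := by gcongr; exact le_max_right _ _

theorem im_discToHalfPlane_pos (hc : ‖c‖ = 1) (him : 0 < c.im) (hz : ‖z‖ < 1) :
    0 < (discToHalfPlane c z).im := by
  have hzc : 0 < ‖z - c‖ := norm_sub_pos_iff.mpr fun h => by simp [h, hc] at hz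
  rw [im_discToHalfPlane hc]
  have : 0 < 1 - ‖z‖ ^ 2 := by nlinarith [norm_nonneg z]
  positivity

theorem differentiableAt_log_discToHalfPlane (hz : z ≠ c)
    (hm : discToHalfPlane c z ∈ slitPlane) :
    DifferentiableAt ℂ (fun z => log (discToHalfPlane c z)) z :=
  DifferentiableAt.clog (DifferentiableAt.fun_div (by fun_prop) (by fun_prop)
    (sub_ne_zero.mpr hz)) hm

theorem im_log_mem_Ioo (hu : 0 < u.im) : (log u).im ∈ Set.Ioo 0 Real.pi := by
  rw [log_im]
  exact ⟨(arg_nonneg_iff.mpr hu.le).lt_of_ne fun h => hu.ne' (arg_eq_zero_iff.mp h.symm).2,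
    arg_lt_pi_iff.mpr (.inr hu.ne')⟩

theorem im_exp_pos (hv : v.im ∈ Set.Ioo 0 Real.pi) : 0 < (exp v).im := by
  rw [exp_im]
  exact mul_pos (Real.exp_pos _) (Real.sin_pos_of_pos_of_lt_pi hv.1 hv.2)

theorem halfPlaneToDisc_exp_mem (hc : ‖c‖ = 1) (hre : 0 ≤ c.re) (him : 0 < c.im) {ε : ℝ}
    (hcε : ‖c - 1‖ < ε) (hv : v.im ∈ Set.Ioo 0 (Real.pi / 2)) :
    halfPlaneToDisc c (exp v) ∈ Metric.ball (0 : ℂ) 1 ∩ Metric.ball 1 ε := by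
  have hexp_im := im_exp_pos ⟨hv.1, hv.2.trans (by linarith [Real.pi_pos])⟩
  have hexp_re : 0 ≤ (exp v).re := by
    rw [exp_re]
    exact mul_nonneg (Real.exp_pos _).le
      (Real.cos_nonneg_of_neg_pi_div_two_le_of_le (by linarith [hv.1, Real.pi_pos]) hv.2.le)
  exact ⟨mem_ball_zero_iff.mpr (norm_halfPlaneToDisc_lt_one hc him hexp_im),
    mem_ball_iff_norm.mpr ((norm_halfPlaneToDisc_sub_one_le hre him hc hexp_re hexp_im).trans_lt
      hcε)⟩

theorem differentiableAt_halfPlaneToDisc_exp (hv : exp v + c ≠ 0) :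
    DifferentiableAt ℂ (fun v => halfPlaneToDisc c (exp v)) v :=
  DifferentiableAt.fun_div (by fun_prop) (by fun_prop) hv

theorem exists_strip_coordinate_one {ε : ℝ} (hε : 0 < ε) : ∃ κ ψ : ℂ → ℂ, ∃ C ≥ 0,
    DifferentiableOn ℂ κ (Metric.ball 0 1) ∧
    Set.MapsTo κ (Metric.ball 0 1) {v | v.im ∈ Set.Ioo 0 Real.pi} ∧
    DifferentiableOn ℂ ψ {v | v.im ∈ Set.Ioo 0 (Real.pi / 2)} ∧
    Set.MapsTo ψ {v | v.im ∈ Set.Ioo 0 (Real.pi / 2)} (Metric.ball 0 1 ∩ Metric.ball 1 ε) ∧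
    (∀ z ∈ Metric.ball 0 1, ψ (κ z) = z) ∧ ∀ z, min 1 ‖κ z‖ ≤ C * ‖z - 1‖ := by
  obtain ⟨c, hc, hre, him, hcε⟩ := exists_norm_eq_one_norm_sub_one_lt hε
  have hc₁ : c ≠ 1 := fun h => by simp [h] at him
  have hc₂ : c ^ 2 ≠ 1 := fun h => by
    rcases eq_or_eq_neg_of_sq_eq_sq c 1 (by rw [h, one_pow]) with rfl | rfl <;> simp at him
  have hne : ∀ z ∈ Metric.ball (0 : ℂ) 1, z ≠ c := fun z hz h => by simp [h, hc] at hz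
  have hpos : ∀ z ∈ Metric.ball (0 : ℂ) 1, 0 < (discToHalfPlane c z).im := fun z hz =>
    im_discToHalfPlane_pos hc him (mem_ball_zero_iff.mp hz)
  have hone := discToHalfPlane_one hc₁
  obtain ⟨C, hC₀, hC⟩ := exists_min_one_norm_le_mul_norm_sub
    (differentiableAt_log_discToHalfPlane hc₁.symm (by simp [hone])) (by simp [hone])
  refine ⟨fun z => log (discToHalfPlane c z), fun v => halfPlaneToDisc c (exp v), C, hC₀,
    fun z hz => ?_, fun z hz => im_log_mem_Ioo (hpos z hz), fun v hv => ?_,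
    fun v hv => halfPlaneToDisc_exp_mem hc hre him hcε hv, fun z hz => ?_, hC⟩
  · exact (differentiableAt_log_discToHalfPlane (hne z hz)
      (.inr (hpos z hz).ne')).differentiableWithinAt
  · exact (differentiableAt_halfPlaneToDisc_exp (add_ne_zero_of_im_pos
      (im_exp_pos ⟨hv.1, hv.2.trans (by linarith [Real.pi_pos])⟩) him)).differentiableWithinAt
  · have : discToHalfPlane c z ≠ 0 := fun h => by simpa [h] using hpos z hz
    simp only [exp_log this, halfPlaneToDisc_discToHalfPlane hc₂ (hne z hz)]

theorem exists_strip_coordinate {w : ℂ} (hw : ‖w‖ = 1) {ε : ℝ} (hε : 0 < ε) :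
    ∃ κ ψ : ℂ → ℂ, ∃ C ≥ 0, DifferentiableOn ℂ κ (Metric.ball 0 1) ∧
      Set.MapsTo κ (Metric.ball 0 1) {v | v.im ∈ Set.Ioo 0 Real.pi} ∧
      DifferentiableOn ℂ ψ {v | v.im ∈ Set.Ioo 0 (Real.pi / 2)} ∧
      Set.MapsTo ψ {v | v.im ∈ Set.Ioo 0 (Real.pi / 2)} (Metric.ball 0 1 ∩ Metric.ball w ε) ∧
      (∀ z ∈ Metric.ball 0 1, ψ (κ z) = z) ∧ ∀ z, min 1 ‖κ z‖ ≤ C * ‖z - w‖ := by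
  have hw₀ : w ≠ 0 := fun h => by simp [h] at hw
  have hsub : ∀ z, ‖w⁻¹ * z - 1‖ = ‖z - w‖ := fun z => by
    rw [← inv_mul_cancel₀ hw₀, ← mul_sub, norm_mul, norm_inv, hw, inv_one, one_mul]
  have hrot : Set.MapsTo (w⁻¹ * ·) (Metric.ball (0 : ℂ) 1) (Metric.ball 0 1) := fun z hz => by
    simpa [hw] using hz
  obtain ⟨κ, ψ, C, hC₀, hκ, hκ_maps, hψ, hψ_maps, hψκ, hC⟩ := exists_strip_coordinate_one hε
  refine ⟨fun z => κ (w⁻¹ * z), fun v => w * ψ v, C, hC₀, hκ.comp (by fun_prop) hrot,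
    fun z hz => hκ_maps (hrot hz), hψ.const_mul w, fun v hv => ?_, fun z hz => ?_, fun z => ?_⟩
  · obtain ⟨h₁, h₂⟩ := hψ_maps hv
    refine ⟨by simpa [hw] using h₁, mem_ball_iff_norm.mpr ?_⟩
    rw [← hsub, inv_mul_cancel_left₀ hw₀]
    exact mem_ball_iff_norm.mp h₂
  · simp only [hψκ _ (hrot hz), mul_inv_cancel_left₀ hw₀]
  · exact hsub z ▸ hC (w⁻¹ * z)

theorem norm_stripExtension_sub_le_mul_min {E : Type*} [NormedAddCommGroup E] [NormedSpace ℂ E]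
    {V : Set E} {f : ℂ × E → ℂ} {M : ℝ} {q : ℂ × E} (hV : IsOpen V)
    (hf : DifferentiableOn ℂ f ({η | η.im ∈ Set.Ioo 0 (Real.pi / 2)} ×ˢ V))
    (hM : ∀ q ∈ {η : ℂ | η.im ∈ Set.Ioo 0 (Real.pi / 2)} ×ˢ V, ‖f q‖ ≤ M)
    (hq : q ∈ {η : ℂ | η.im ∈ Set.Ioo 0 Real.pi} ×ˢ V) (hfq : ‖f q‖ ≤ M) :
    ‖stripExtension f q - f q‖ ≤ 72 * M * min 1 ‖q.1‖ := by
  have hM₀ : 0 ≤ M := (norm_nonneg _).trans hfq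
  rcases lt_or_ge ‖q.1‖ (3 / 4) with hq₁ | hq₁
  · refine (norm_stripExtension_sub_le hV hf hM hq.2 hq₁).trans ?_
    rw [min_eq_right (by linarith)]
    gcongr
    norm_num
  · calc ‖stripExtension f q - f q‖ ≤ 53 * M + M :=
          norm_sub_le_of_le (norm_stripExtension_le hM hq) hfq
      _ = 72 * M * (3 / 4) := by ring
      _ ≤ 72 * M * min 1 ‖q.1‖ := by gcongr; exact le_min (by norm_num) hq₁

variable {E : Type*} [NormedAddCommGroup E] [NormedSpace ℂ E] {V : Set E}

theorem exists_disc_extension_of_norm_eq_one {w : ℂ} (hw : ‖w‖ = 1) {ε : ℝ} (hε : 0 < ε)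
    (hV : IsOpen V) : ∃ C ≥ 0, ∀ (f : ℂ × E → ℂ) (M : ℝ),
      DifferentiableOn ℂ f ((Metric.ball 0 1 ∩ Metric.ball w ε) ×ˢ V) →
      (∀ q ∈ (Metric.ball 0 1 ∩ Metric.ball w ε) ×ˢ V, ‖f q‖ ≤ M) →
      ∃ P : ℂ × E → ℂ, DifferentiableOn ℂ P (Metric.ball 0 1 ×ˢ V) ∧
        (∀ q ∈ Metric.ball 0 1 ×ˢ V, ‖P q‖ ≤ 53 * M) ∧
        ∀ q ∈ (Metric.ball 0 1 ∩ Metric.ball w ε) ×ˢ V, ‖P q - f q‖ ≤ C * M * ‖q.1 - w‖ := by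
  obtain ⟨κ, ψ, C, hC₀, hκ, hκ_maps, hψ, hψ_maps, hψκ, hC⟩ := exists_strip_coordinate hw hε
  refine ⟨72 * C, by positivity, fun f M hf hM => ?_⟩
  let g : ℂ × E → ℂ := fun q => f (ψ q.1, q.2)
  have hg_maps : Set.MapsTo (fun q : ℂ × E => (ψ q.1, q.2))
      ({v | v.im ∈ Set.Ioo 0 (Real.pi / 2)} ×ˢ V)
      ((Metric.ball 0 1 ∩ Metric.ball w ε) ×ˢ V) := fun q hq => ⟨hψ_maps hq.1, hq.2⟩
  have hg : DifferentiableOn ℂ g ({v | v.im ∈ Set.Ioo 0 (Real.pi / 2)} ×ˢ V) :=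
    hf.comp ((hψ.comp differentiableOn_fst fun q hq => hq.1).prodMk differentiableOn_snd) hg_maps
  have hgM : ∀ q ∈ {v : ℂ | v.im ∈ Set.Ioo 0 (Real.pi / 2)} ×ˢ V, ‖g q‖ ≤ M := fun q hq =>
    hM _ (hg_maps hq)
  have hκ_maps' : Set.MapsTo (fun q : ℂ × E => (κ q.1, q.2)) (Metric.ball 0 1 ×ˢ V)
      ({v | v.im ∈ Set.Ioo 0 Real.pi} ×ˢ V) := fun q hq => ⟨hκ_maps hq.1, hq.2⟩
  refine ⟨fun q => stripExtension g (κ q.1, q.2),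
    (differentiableOn_stripExtension hV hg hgM).comp
      ((hκ.comp differentiableOn_fst fun q hq => hq.1).prodMk differentiableOn_snd) hκ_maps',
    fun q hq => norm_stripExtension_le hgM (hκ_maps' hq), fun q hq => ?_⟩
  have hgq : g (κ q.1, q.2) = f q := by simp only [g, hψκ _ hq.1.1]
  have hM₀ : 0 ≤ M := (norm_nonneg _).trans (hM q hq)
  calc ‖stripExtension g (κ q.1, q.2) - f q‖ ≤ 72 * M * min 1 ‖κ q.1‖ := hgq ▸
        norm_stripExtension_sub_le_mul_min hV hg hgM (hκ_maps' ⟨hq.1.1, hq.2⟩) (hgq ▸ hM q hq)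
    _ ≤ 72 * M * (C * ‖q.1 - w‖) := by gcongr; exact hC q.1
    _ = 72 * C * M * ‖q.1 - w‖ := by ring

theorem exists_disc_extension {w : ℂ} (hw : ‖w‖ ≤ 1) {ε : ℝ} (hε : 0 < ε) (hV : IsOpen V) :
    ∃ C ≥ 0, ∀ (f : ℂ × E → ℂ) (M : ℝ),
      DifferentiableOn ℂ f ((Metric.ball 0 1 ∩ Metric.ball w ε) ×ˢ V) →
      (∀ q ∈ (Metric.ball 0 1 ∩ Metric.ball w ε) ×ˢ V, ‖f q‖ ≤ M) →
      ∃ P : ℂ × E → ℂ, DifferentiableOn ℂ P (Metric.ball 0 1 ×ˢ V) ∧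
        (∀ q ∈ Metric.ball 0 1 ×ˢ V, ‖P q‖ ≤ 53 * M) ∧
        ∀ q ∈ (Metric.ball 0 1 ∩ Metric.ball w ε) ×ˢ V, ‖P q - f q‖ ≤ C * M * ‖q.1 - w‖ := by
  rcases hw.eq_or_lt with hw | hw
  · exact exists_disc_extension_of_norm_eq_one hw hε hV
  have hwU : w ∈ Metric.ball 0 1 ∩ Metric.ball w ε :=
    ⟨mem_ball_zero_iff.mpr hw, Metric.mem_ball_self hε⟩
  obtain ⟨r, hr, hrU⟩ :=
    Metric.isOpen_iff.mp (Metric.isOpen_ball.inter Metric.isOpen_ball) w hwU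
  refine ⟨2 / r, by positivity, fun f M hf hM => ⟨fun q => f (w, q.2),
    hf.comp (by fun_prop) fun q hq => ⟨hwU, hq.2⟩, fun q hq => ?_, fun q hq => ?_⟩⟩
  · have := hM (w, q.2) ⟨hwU, hq.2⟩
    linarith [(norm_nonneg _).trans this]
  · have hslice := norm_dslope_le_of_bounded (f := fun z => f (z, q.2)) hr hrU
      (hf.comp (by fun_prop) fun z hz => ⟨hrU hz, hq.2⟩) (fun z hz => hM _ ⟨hz, hq.2⟩) hq.1
    calc ‖f (w, q.2) - f q‖ = ‖q.1 - w‖ * ‖dslope (fun z => f (z, q.2)) w q.1‖ := by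
          rw [norm_sub_rev, ← norm_smul, sub_smul_dslope]
      _ ≤ ‖q.1 - w‖ * (2 * M / r) := by gcongr
      _ = 2 / r * M * ‖q.1 - w‖ := by ring

end DiscExtension

theorem exists_algHom_comp_eq {R A B C : Type*} [CommRing R] [CommRing A] [CommRing B] [CommRing C]
    [Algebra R A] [Algebra R B] [Algebra R C] (ρ : A →ₐ[R] B) (I : Ideal B)
    (hρ : ∀ b, ∃ a, ρ a - b ∈ I) {τ : A →ₐ[R] C} (hτ : ∀ a, ρ a ∈ I → τ a = 0) :
    ∃ σ : B →ₐ[R] C, σ.comp ρ = τ := by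
  let q : A →ₐ[R] B ⧸ I := (Ideal.Quotient.mkₐ R I).comp ρ
  have hq : Function.Surjective q := fun y => by
    obtain ⟨b, rfl⟩ := Ideal.Quotient.mkₐ_surjective R I y
    exact (hρ b).imp fun a ha => Ideal.Quotient.eq.mpr ha
  have hker : RingHom.ker q ≤ RingHom.ker τ := fun a ha =>
    hτ a (Ideal.Quotient.eq_zero_iff_mem.mp ha)
  exact ⟨(AlgHom.liftOfSurjective q hq τ hker).comp (Ideal.Quotient.mkₐ R I),
    AlgHom.liftOfSurjective_comp q hq τ hker⟩

section HInfOn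

variable {X : Type*} [NormedAddCommGroup X] [NormedSpace ℂ X] {U V : Set X} {δ : ℝ}

/-- The algebra `H^∞(V)` of bounded holomorphic functions on an open set `V`, with the same encoding
as `HInf X`, which is the case of the open unit ball. -/
def HInfOn (V : Set X) : Subalgebra ℂ (V →ᵇ ℂ) where
  carrier := {f | ∃ F : X → ℂ, DifferentiableOn ℂ F V ∧ ∀ x : V, F x = f x}
  mul_mem' := by
    rintro f g ⟨F, hF, hFf⟩ ⟨G, hG, hGg⟩
    exact ⟨F * G, hF.mul hG, fun x => by simp [hFf, hGg]⟩
  add_mem' := by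
    rintro f g ⟨F, hF, hFf⟩ ⟨G, hG, hGg⟩
    exact ⟨F + G, hF.add hG, fun x => by simp [hFf, hGg]⟩
  algebraMap_mem' c := ⟨fun _ => c, differentiableOn_const c, fun _ => rfl⟩

namespace HInfOn

/-- The element of `H^∞(V)` given by a function bounded and holomorphic on `V`. -/
noncomputable def ofBounded (F : X → ℂ) (hF : DifferentiableOn ℂ F V) (M : ℝ)
    (hM : ∀ x ∈ V, ‖F x‖ ≤ M) : HInfOn V :=
  ⟨.ofNormedAddCommGroup (fun x : V => F x) hF.continuousOn.domRestrict M fun x => hM x x.2,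
    F, hF, fun _ => rfl⟩

/-- Restriction of bounded holomorphic functions to a smaller set. -/
noncomputable def restrict (h : U ⊆ V) : HInfOn V →ₐ[ℂ] HInfOn U where
  toFun f := ⟨f.1.compContinuous ⟨Set.inclusion h, continuous_inclusion h⟩,
    f.2.imp fun _ hF => ⟨hF.1.mono h, fun x => hF.2 (Set.inclusion h x)⟩⟩
  map_one' := rfl
  map_mul' _ _ := rfl
  map_zero' := rfl
  map_add' _ _ := rfl
  commutes' _ := rfl

/-- The ideal of all `e` with `e = O(a)` uniformly on `V`. -/
def dominatedIdeal (a : HInfOn V) : Ideal (HInfOn V) where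
  carrier := {e | ∃ C, ∀ x, ‖e.1 x‖ ≤ C * ‖a.1 x‖}
  zero_mem' := ⟨0, fun x => by simp⟩
  add_mem' := by
    rintro e₁ e₂ ⟨C₁, h₁⟩ ⟨C₂, h₂⟩
    exact ⟨C₁ + C₂, fun x => (norm_add_le_of_le (h₁ x) (h₂ x)).trans_eq (add_mul _ _ _).symm⟩
  smul_mem' := by
    rintro g e ⟨C, h⟩
    refine ⟨‖g.1‖ * C, fun x => (norm_mul_le _ _).trans ?_⟩
    rw [mul_assoc]
    exact mul_le_mul (g.1.norm_coe_le_norm x) (h x) (norm_nonneg _) (norm_nonneg _)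

theorem dvd_pow_three_of_mem_dominatedIdeal (hV : IsOpen V) {a e : HInfOn V}
    (he : e ∈ dominatedIdeal a) : a ∣ e ^ 3 := by
  obtain ⟨C, hC⟩ := he
  obtain ⟨E, hE, hEe⟩ := e.2
  obtain ⟨A, hA, hAa⟩ := a.2
  have hEA : ∀ x ∈ V, ‖E x‖ ≤ C * ‖A x‖ := fun x hx => by
    simpa only [← hEe, ← hAa] using hC ⟨x, hx⟩
  have hbound : ∀ x ∈ V, ‖E x ^ 3 / A x‖ ≤ |C| ^ 3 * ‖a.1‖ ^ 2 := fun x hx => by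
    refine (norm_pow_three_div_le (hEA x hx)).trans ?_
    have : ‖A x‖ ≤ ‖a.1‖ := hAa ⟨x, hx⟩ ▸ a.1.norm_coe_le_norm _
    rw [← abs_pow]
    gcongr
    exact le_abs_self _
  refine ⟨ofBounded _ (differentiableOn_pow_three_div hV hE hA hEA) _ hbound,
    Subtype.ext (BoundedContinuousFunction.ext fun x => ?_)⟩
  change e.1 x ^ 3 = a.1 x * (E x ^ 3 / A x)
  rw [hAa, hEe, mul_div_cancel_of_imp' fun h => ?_]
  have := hC x
  rw [h, norm_zero, mul_zero, norm_le_zero_iff] at this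
  rw [this, zero_pow three_ne_zero]

theorem isUnit_of_forall_le_norm {f : HInfOn V} (hδ : 0 < δ) (h : ∀ x, δ ≤ ‖f.1 x‖) :
    IsUnit f := by
  obtain ⟨F, hF, hFf⟩ := f.2
  have hne : ∀ x ∈ V, F x ≠ 0 := fun x hx =>
    norm_pos_iff.mp (hFf ⟨x, hx⟩ ▸ hδ.trans_le (h ⟨x, hx⟩))
  refine IsUnit.of_mul_eq_one (ofBounded (fun x => (F x)⁻¹) (hF.fun_inv hne) δ⁻¹ fun x hx => ?_)
    (Subtype.ext (BoundedContinuousFunction.ext fun x => ?_))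
  · rw [norm_inv]
    exact inv_anti₀ hδ (hFf ⟨x, hx⟩ ▸ h ⟨x, hx⟩)
  · change f.1 x * (F x)⁻¹ = 1
    rw [hFf, mul_inv_cancel₀ (norm_pos_iff.mp (hδ.trans_le (h x)))]

theorem exists_norm_sub_lt (τ : HInfOn V →ₐ[ℂ] ℂ) (f : HInfOn V) (hδ : 0 < δ) :
    ∃ x, ‖f.1 x - τ f‖ < δ := by
  by_contra! h
  have hunit : IsUnit (f - algebraMap ℂ _ (τ f)) := isUnit_of_forall_le_norm hδ h
  exact (hunit.map τ).ne_zero (by simp)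

theorem mem_dominatedIdeal_of_restrict (hUV : U ⊆ V) {a e : HInfOn V} (hδ : 0 < δ)
    (ha : ∀ x : V, x.1 ∉ U → δ ≤ ‖a.1 x‖)
    (he : restrict hUV e ∈ dominatedIdeal (restrict hUV a)) : e ∈ dominatedIdeal a := by
  obtain ⟨C, hC⟩ := he
  refine ⟨max C (‖e.1‖ / δ), fun x => ?_⟩
  by_cases hx : x.1 ∈ U
  · refine (hC ⟨x, hx⟩).trans ?_
    change C * ‖a.1 x‖ ≤ _
    gcongr
    exact le_max_left _ _
  · calc ‖e.1 x‖ ≤ ‖e.1‖ / δ * δ := by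
          rw [div_mul_cancel₀ _ hδ.ne']
          exact e.1.norm_coe_le_norm x
      _ ≤ max C (‖e.1‖ / δ) * ‖a.1 x‖ := by
          gcongr
          · exact le_max_right _ _
          · exact ha x hx

theorem exists_algHom_comp_restrict_eq (hV : IsOpen V) (hUV : U ⊆ V) {a : HInfOn V} (hδ : 0 < δ)
    (ha : ∀ x : V, x.1 ∉ U → δ ≤ ‖a.1 x‖)
    (happrox : ∀ g : HInfOn U, ∃ P, restrict hUV P - g ∈ dominatedIdeal (restrict hUV a))
    {τ : HInfOn V →ₐ[ℂ] ℂ} (hτ : τ a = 0) :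
    ∃ σ : HInfOn U →ₐ[ℂ] ℂ, σ.comp (restrict hUV) = τ := by
  refine exists_algHom_comp_eq (restrict hUV) (dominatedIdeal (restrict hUV a)) happrox
    fun e he => ?_
  have hdvd := map_dvd τ (dvd_pow_three_of_mem_dominatedIdeal hV
    (mem_dominatedIdeal_of_restrict hUV hδ ha he))
  rw [hτ, zero_dvd_iff, map_pow] at hdvd
  exact (pow_eq_zero_iff three_ne_zero).mp hdvd

end HInfOn

end HInfOn

section Cylinders

variable {K : Type*} [TopologicalSpace K]

/-- The function `(1 - φ) x + φ ζ`, which moves the value of `x` to `ζ` where `φ = 1`. -/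
noncomputable def blend (φ : C(K, ℝ)) (ζ : ℂ) (x : C(K, ℂ)) : C(K, ℂ) :=
  x + (⟨fun k => (φ k : ℂ), by fun_prop⟩ : C(K, ℂ)) * (ζ • 1 - x)

theorem blend_apply (φ : C(K, ℝ)) (ζ : ℂ) (x : C(K, ℂ)) (k : K) :
    blend φ ζ x k = x k + φ k • (ζ - x k) := by
  simp [blend]

theorem exists_bump [CompactSpace K] [T2Space K] {t : K} {W : Set K} (hW : IsOpen W)
    (ht : t ∈ W) :
    ∃ φ : C(K, ℝ), φ t = 1 ∧ (∀ k ∉ W, φ k = 0) ∧ ∀ k, φ k ∈ Set.Icc (0 : ℝ) 1 := by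
  obtain ⟨φ, h0, h1, h⟩ := exists_continuous_zero_one_of_isClosed hW.isClosed_compl
    (isClosed_singleton (x := t)) (by simpa using ht)
  exact ⟨φ, h1 rfl, fun k hk => h0 hk, h⟩

variable [CompactSpace K] {w : K → ℂ} {ε : ℝ} {S : Finset K} {t : K}

theorem differentiable_blend (φ : C(K, ℝ)) :
    Differentiable ℂ fun q : ℂ × C(K, ℂ) => blend φ q.1 q.2 := by
  unfold blend
  fun_prop

theorem tendsto_blend {φ : TopologicalSpace.OpenNhdsOf t → C(K, ℝ)}
    (hφ : ∀ W k, φ W k ∈ Set.Icc (0 : ℝ) 1)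
    (hφW : ∀ W : TopologicalSpace.OpenNhdsOf t, ∀ k ∉ (W : Set K), φ W k = 0) (x : C(K, ℂ)) :
    Tendsto (fun W => blend (φ W) (x t) x) atBot (𝓝 x) := by
  rw [Metric.tendsto_nhds]
  intro η hη
  let W₀ : TopologicalSpace.OpenNhdsOf t :=
    ⟨⟨{k | ‖x t - x k‖ < η}, isOpen_lt (by fun_prop) continuous_const⟩, by simpa using hη⟩
  filter_upwards [eventually_le_atBot W₀] with W hW
  rw [dist_eq_norm, ContinuousMap.norm_lt_iff _ hη]
  intro k
  rw [ContinuousMap.sub_apply, blend_apply, add_sub_cancel_left, norm_smul,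
    Real.norm_of_nonneg (hφ W k).1]
  by_cases hk : k ∈ (W : Set K)
  · exact (mul_le_of_le_one_left (norm_nonneg _) (hφ W k).2).trans_lt (hW hk)
  · rwa [hφW W k hk, zero_mul]

/-- The functions in the open unit ball of `C(K)` whose values at the points of `S` are `ε`-close
to the values prescribed by `w`. -/
def cylinder (w : K → ℂ) (ε : ℝ) (S : Finset K) : Set C(K, ℂ) :=
  {x | x ∈ UnitBall C(K, ℂ) ∧ ∀ s ∈ S, x s ∈ Metric.ball (w s) ε}

theorem cylinder_subset_unitBall : cylinder w ε S ⊆ UnitBall C(K, ℂ) := fun _ hx => hx.1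

theorem cylinder_cons_subset (ht : t ∉ S) : cylinder w ε (S.cons t ht) ⊆ cylinder w ε S :=
  fun _ hx => ⟨hx.1, fun s hs => hx.2 s (Finset.mem_cons_of_mem hs)⟩

theorem isOpen_cylinder : IsOpen (cylinder w ε S) := by
  have : cylinder w ε S =
      UnitBall C(K, ℂ) ∩ ⋂ s ∈ S, (fun x : C(K, ℂ) => x s) ⁻¹' Metric.ball (w s) ε := by
    ext x; simp [cylinder]
  rw [this]
  exact Metric.isOpen_ball.inter
    (isOpen_biInter_finset fun s _ => Metric.isOpen_ball.preimage (by fun_prop))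

theorem apply_mem_ball {x : C(K, ℂ)} (hx : x ∈ UnitBall C(K, ℂ)) (k : K) :
    x k ∈ Metric.ball (0 : ℂ) 1 :=
  mem_ball_zero_iff.mpr ((x.norm_coe_le_norm k).trans_lt (mem_ball_zero_iff.mp hx))

theorem blend_mem_cylinder {φ : C(K, ℝ)} (hφ : ∀ k, φ k ∈ Set.Icc (0 : ℝ) 1) (hφt : φ t = 1)
    (hφS : ∀ s ∈ S, φ s = 0) (ht : t ∉ S) {ζ : ℂ}
    (hζ : ζ ∈ Metric.ball 0 1 ∩ Metric.ball (w t) ε) {x : C(K, ℂ)} (hx : x ∈ cylinder w ε S) :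
    blend φ ζ x ∈ cylinder w ε (S.cons t ht) := by
  refine ⟨mem_ball_zero_iff.mpr ((ContinuousMap.norm_lt_iff _ one_pos).mpr fun k => ?_), ?_⟩
  · rw [blend_apply, ← mem_ball_zero_iff]
    exact (convex_ball (0 : ℂ) 1).add_smul_sub_mem (apply_mem_ball hx.1 k) hζ.1 (hφ k)
  · rintro s hs
    rw [blend_apply]
    rcases Finset.mem_cons.mp hs with rfl | hs
    · simpa [hφt] using hζ.2
    · simpa [hφS s hs] using hx.2 s hs

theorem exists_differentiableOn_cylinder_approx [T2Space K] (hε : 0 < ε) (hwt : ‖w t‖ ≤ 1)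
    (ht : t ∉ S) {G : C(K, ℂ) → ℂ} {M : ℝ}
    (hG : DifferentiableOn ℂ G (cylinder w ε (S.cons t ht)))
    (hM : ∀ x ∈ cylinder w ε (S.cons t ht), ‖G x‖ ≤ M) :
    ∃ F : C(K, ℂ) → ℂ, DifferentiableOn ℂ F (cylinder w ε S) ∧
      (∀ x ∈ cylinder w ε S, ‖F x‖ ≤ 53 * M) ∧
      ∃ C, ∀ x ∈ cylinder w ε (S.cons t ht), ‖F x - G x‖ ≤ C * ‖x t - w t‖ := by
  obtain ⟨C, -, hC⟩ := exists_disc_extension hwt hε (isOpen_cylinder (w := w) (ε := ε) (S := S))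
  have hbump : ∀ W : TopologicalSpace.OpenNhdsOf t, ∃ φ : C(K, ℝ), φ t = 1 ∧
      (∀ k ∉ (W : Set K) ∩ (S : Set K)ᶜ, φ k = 0) ∧ ∀ k, φ k ∈ Set.Icc (0 : ℝ) 1 := fun W =>
    exists_bump (W.isOpen.inter S.finite_toSet.isClosed.isOpen_compl) ⟨W.mem, by simpa using ht⟩
  choose φ hφt hφ₀ hφ using hbump
  have hblend : ∀ W, Set.MapsTo (fun q : ℂ × C(K, ℂ) => blend (φ W) q.1 q.2)
      ((Metric.ball 0 1 ∩ Metric.ball (w t) ε) ×ˢ cylinder w ε S)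
      (cylinder w ε (S.cons t ht)) := fun W q hq =>
    blend_mem_cylinder (hφ W) (hφt W) (fun s hs => hφ₀ W s fun h => h.2 hs) ht hq.1 hq.2
  choose P hP hPM hPG using fun W => hC (fun q => G (blend (φ W) q.1 q.2)) M
    (hG.comp (differentiable_blend (φ W)).differentiableOn (hblend W))
    (fun q hq => hM _ (hblend W hq))
  have hgraph : Set.MapsTo (fun x : C(K, ℂ) => (x t, x)) (cylinder w ε S)
      (Metric.ball 0 1 ×ˢ cylinder w ε S) := fun x hx => ⟨apply_mem_ball hx.1 t, hx⟩
  have heval : Differentiable ℂ fun x : C(K, ℂ) => (x t, x) :=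
    (ContinuousMap.evalCLM ℂ t : C(K, ℂ) →L[ℂ] ℂ).differentiable.prodMk differentiable_id
  let 𝒰 : Ultrafilter (TopologicalSpace.OpenNhdsOf t) := Ultrafilter.of atBot
  obtain ⟨F, hF, hFM, hlim⟩ := exists_differentiableOn_tendsto_ultrafilter 𝒰
    (isOpen_cylinder (w := w) (ε := ε) (S := S)) (g := fun W x => P W (x t, x)) (M := 53 * M)
    (Eventually.of_forall fun W => ⟨(hP W).comp heval.differentiableOn hgraph,
      fun x hx => hPM W _ (hgraph hx)⟩)
  refine ⟨F, hF, hFM, C * M, fun x hx => ?_⟩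
  have hxS := cylinder_cons_subset ht hx
  have hGx : Tendsto (fun W => G (blend (φ W) (x t) x)) 𝒰 (𝓝 (G x)) :=
    ((hG.continuousOn.continuousAt (isOpen_cylinder.mem_nhds hx)).tendsto.comp
      (tendsto_blend hφ (fun W k hk => hφ₀ W k fun h => hk h.1) x)).mono_left
      (Ultrafilter.of_le _)
  exact le_of_tendsto ((hlim x hxS).sub hGx).norm (Eventually.of_forall fun W =>
    hPG W (x t, x) ⟨⟨apply_mem_ball hx.1 t, hx.2 t (Finset.mem_cons_self t S)⟩, hxS⟩)

theorem exists_restrict_sub_mem_dominatedIdeal [T2Space K] (hε : 0 < ε) (hwt : ‖w t‖ ≤ 1)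
    (ht : t ∉ S) (g : HInfOn (cylinder w ε (S.cons t ht))) {a : HInfOn (cylinder w ε S)}
    (ha : ∀ x, a.1 x = x.1 t - w t) :
    ∃ P, HInfOn.restrict (cylinder_cons_subset ht) P - g ∈
      HInfOn.dominatedIdeal (HInfOn.restrict (cylinder_cons_subset ht) a) := by
  obtain ⟨G, hG, hGg⟩ := g.2
  have hM : ∀ x ∈ cylinder w ε (S.cons t ht), ‖G x‖ ≤ ‖g.1‖ := fun x hx =>
    hGg ⟨x, hx⟩ ▸ g.1.norm_coe_le_norm _
  obtain ⟨F, hF, hFM, C, hC⟩ := exists_differentiableOn_cylinder_approx hε hwt ht hG hM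
  refine ⟨HInfOn.ofBounded F hF _ hFM, C, fun x => ?_⟩
  change ‖F x - g.1 x‖ ≤ C * ‖a.1 (Set.inclusion (cylinder_cons_subset ht) x)‖
  rw [ha, ← hGg]
  exact hC x x.2

theorem exists_algHom_cylinder [T2Space K] (hw : ∀ k, ‖w k‖ ≤ 1) (hε : 0 < ε)
    (τ : HInf C(K, ℂ) →ₐ[ℂ] ℂ) (hτ : ∀ k, τ (restrictFun (ContinuousMap.evalCLM ℂ k)) = w k)
    (S : Finset K) :
    ∃ σ : HInfOn (cylinder w ε S) →ₐ[ℂ] ℂ,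
      σ.comp (HInfOn.restrict (V := UnitBall C(K, ℂ)) cylinder_subset_unitBall) = τ := by
  induction S using Finset.cons_induction with
  | empty =>
    exact ⟨τ.comp (HInfOn.restrict (U := UnitBall C(K, ℂ)) fun x hx => ⟨hx, by simp⟩), rfl⟩
  | cons t S ht ih =>
    obtain ⟨σ, hσ⟩ := ih
    let δt : HInf C(K, ℂ) := restrictFun (ContinuousMap.evalCLM ℂ t)
    let a : HInfOn (cylinder w ε S) :=
      HInfOn.restrict (V := UnitBall C(K, ℂ)) cylinder_subset_unitBall δt - algebraMap ℂ _ (w t)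
    have hσa : σ a = 0 := by
      rw [map_sub, AlgHom.commutes, sub_eq_zero]
      exact (DFunLike.congr_fun hσ δt).trans (hτ t)
    have ha : ∀ x : cylinder w ε S, x.1 ∉ cylinder w ε (S.cons t ht) → ε ≤ ‖a.1 x‖ := fun x hx => by
      by_contra! h
      exact hx ⟨x.2.1, fun s hs => (Finset.mem_cons.mp hs).elim
        (fun hst => hst ▸ mem_ball_iff_norm.mpr h) (x.2.2 s)⟩
    obtain ⟨σ', hσ'⟩ := HInfOn.exists_algHom_comp_restrict_eq isOpen_cylinder
      (cylinder_cons_subset ht) hε ha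
      (fun g => exists_restrict_sub_mem_dominatedIdeal hε (hw t) ht g (a := a) fun _ => rfl) hσa
    refine ⟨σ', ?_⟩
    rw [← hσ, ← hσ', AlgHom.comp_assoc]
    rfl

theorem exists_mem_cylinder_norm_sub_lt [T2Space K] (hw : ∀ k, ‖w k‖ ≤ 1) (hε : 0 < ε)
    (τ : HInf C(K, ℂ) →ₐ[ℂ] ℂ) (hτ : ∀ k, τ (restrictFun (ContinuousMap.evalCLM ℂ k)) = w k)
    (f : HInf C(K, ℂ)) (S : Finset K) :
    ∃ b : UnitBall C(K, ℂ), (∀ s ∈ S, ‖b.1 s - w s‖ < ε) ∧ ‖f.1 b - τ f‖ < ε := by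
  obtain ⟨σ, rfl⟩ := exists_algHom_cylinder hw hε τ hτ S
  obtain ⟨x, hx⟩ := HInfOn.exists_norm_sub_lt σ (HInfOn.restrict cylinder_subset_unitBall f) hε
  exact ⟨⟨x, x.2.1⟩, fun s hs => mem_ball_iff_norm.mp (x.2.2 s hs), hx⟩

end Cylinders

section PointEvaluations

theorem norm_apply_add_norm_apply_le {E : Type*} [NormedAddCommGroup E] [NormedSpace ℂ E]
    (φ : StrongDual ℂ E) {u v : E} {M : ℝ} (h : ∀ θ : ℂ, ‖θ‖ = 1 → ‖u + θ • v‖ ≤ M) :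
    ‖φ u‖ + ‖φ v‖ ≤ ‖φ‖ * M := by
  obtain ⟨α, hα, hαu⟩ := RCLike.exists_norm_mul_eq_self (φ u)
  obtain ⟨β, hβ, hβv⟩ := RCLike.exists_norm_eq_mul_self (φ v)
  have hsum : φ (u + (α * β) • v) = α * (‖φ u‖ + ‖φ v‖ : ℝ) := by
    rw [map_add, map_smul, smul_eq_mul, mul_assoc, ← hβv, Complex.ofReal_add, mul_add]
    exact congrArg (· + α * (‖φ v‖ : ℂ)) hαu.symm
  calc ‖φ u‖ + ‖φ v‖ = ‖φ (u + (α * β) • v)‖ := by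
        rw [hsum, norm_mul, hα, one_mul, Complex.norm_of_nonneg (by positivity)]
    _ ≤ ‖φ‖ * M := φ.le_opNorm_of_le (h _ (by rw [norm_mul, hα, hβ, one_mul]))

variable {K : Type*} [TopologicalSpace K] [CompactSpace K]

theorem exists_isOpen_norm_apply_le (φ : StrongDual ℂ C(K, ℂ)) (t : K) {η : ℝ} (hη : 0 < η) :
    ∃ W : Set K, IsOpen W ∧ t ∈ W ∧ ∀ h : C(K, ℂ), (∀ k ∉ W, h k = 0) → h t = 0 →
      ‖φ h‖ ≤ η * ‖h‖ := by
  let N : Submodule ℂ C(K, ℂ) := (ContinuousMap.evalCLM ℂ t : C(K, ℂ) →L[ℂ] ℂ).ker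
  let ψ : StrongDual ℂ N := φ.comp N.subtypeL
  obtain ⟨u, hu, hψu⟩ := ψ.exists_lt_apply_of_lt_opNorm (sub_lt_self ‖ψ‖ (half_pos hη))
  have hut : u.1 t = 0 := u.2
  obtain ⟨ν, hν, hνψ⟩ : ∃ ν > 0, ‖ψ‖ * ν < η / 2 := exists_pos_mul_lt (half_pos hη) ‖ψ‖
  refine ⟨{k | ‖u.1 k‖ < ν}, isOpen_lt (by fun_prop) continuous_const, by simpa [hut] using hν,
    fun h hW ht => ?_⟩
  have hsum : ∀ θ : ℂ, ‖θ‖ = 1 →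
      ‖(‖h‖ : ℂ) • u + θ • (⟨h, ht⟩ : N)‖ ≤ ‖h‖ * (1 + ν) := fun θ hθ => by
    refine (ContinuousMap.norm_le _ (by positivity)).mpr fun k => ?_
    have hk : ‖h k‖ ≤ ‖h‖ := h.norm_coe_le_norm k
    have huk : ‖u.1 k‖ ≤ 1 := (u.1.norm_coe_le_norm k).trans hu.le
    calc ‖(‖h‖ : ℂ) * u.1 k + θ * h k‖ ≤ ‖h‖ * ‖u.1 k‖ + ‖h k‖ := by
          simpa [hθ] using norm_add_le ((‖h‖ : ℂ) * u.1 k) (θ * h k)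
      _ ≤ ‖h‖ * (1 + ν) := by
          by_cases hkW : ‖u.1 k‖ < ν
          · nlinarith [norm_nonneg h]
          · rw [hW k hkW, norm_zero, add_zero]
            gcongr
            linarith
  have hle : ‖h‖ * ‖ψ u‖ + ‖φ h‖ ≤ ‖ψ‖ * (‖h‖ * (1 + ν)) := by
    have := norm_apply_add_norm_apply_le ψ hsum
    rwa [map_smul, norm_smul, Complex.norm_real, norm_norm] at this
  nlinarith [norm_nonneg h]

/-- The functional `h ↦ φ (g h)` as a function of `g`; for `φ` a measure this is the measure with
density `g`. -/
noncomputable def mulDual (φ : StrongDual ℂ C(K, ℂ)) : C(K, ℂ) →L[ℂ] StrongDual ℂ C(K, ℂ) :=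
  (ContinuousLinearMap.compL ℂ C(K, ℂ) C(K, ℂ) ℂ φ).comp (ContinuousLinearMap.mul ℂ C(K, ℂ))

theorem mulDual_apply (φ : StrongDual ℂ C(K, ℂ)) (g h : C(K, ℂ)) : mulDual φ g h = φ (g * h) :=
  rfl

theorem mulDual_one (φ : StrongDual ℂ C(K, ℂ)) : mulDual φ 1 = φ := by
  ext h
  rw [mulDual_apply, one_mul]

theorem exists_norm_mulDual_sub_le [T2Space K] (φ : StrongDual ℂ C(K, ℂ)) {t : K} {U : Set K}
    (hU : IsOpen U) (ht : t ∈ U) {η : ℝ} (hη : 0 < η) :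
    ∃ b : C(K, ℂ), b t = 1 ∧ (∀ k ∉ U, b k = 0) ∧
      ‖mulDual φ b - φ b • ContinuousMap.evalCLM ℂ t‖ ≤ η := by
  obtain ⟨W, hW, htW, hφW⟩ := exists_isOpen_norm_apply_le φ t (half_pos hη)
  obtain ⟨b₀, hb₀t, hb₀, hb₀I⟩ := exists_bump (hW.inter hU) ⟨htW, ht⟩
  let b : C(K, ℂ) := ⟨fun k => (b₀ k : ℂ), by fun_prop⟩
  have hbt : b t = 1 := by simp [b, hb₀t]
  have hb : ∀ k ∉ W ∩ U, b k = 0 := fun k hk => by simp [b, hb₀ k hk]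
  have hb1 : ‖b‖ ≤ 1 := (ContinuousMap.norm_le _ zero_le_one).mpr fun k => by
    simpa [b, abs_of_nonneg (hb₀I k).1] using (hb₀I k).2
  refine ⟨b, hbt, fun k hk => hb k fun h => hk h.2,
    ContinuousLinearMap.opNorm_le_bound _ hη.le fun g => ?_⟩
  have hnorm : ‖b * g - g t • b‖ ≤ 2 * ‖g‖ :=
    calc ‖b * g - g t • b‖ ≤ ‖b‖ * ‖g‖ + ‖g t‖ * ‖b‖ :=
          norm_sub_le_of_le (norm_mul_le b g) (norm_smul_le (g t) b)
      _ ≤ 1 * ‖g‖ + ‖g‖ * 1 := by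
          gcongr
          exact g.norm_coe_le_norm t
      _ = 2 * ‖g‖ := by ring
  calc ‖(mulDual φ b - φ b • (ContinuousMap.evalCLM ℂ t : StrongDual ℂ C(K, ℂ))) g‖
      = ‖φ (b * g - g t • b)‖ := by
        rw [map_sub, map_smul, smul_eq_mul, mul_comm (g t)]
        rfl
    _ ≤ η / 2 * ‖b * g - g t • b‖ := hφW _ (fun k hk => by simp [hb k fun h => hk h.1])
        (by simp [hbt])
    _ ≤ η / 2 * (2 * ‖g‖) := by gcongr
    _ = η * ‖g‖ := by ring

variable {φ : StrongDual ℂ C(K, ℂ)} {E : Submodule ℂ (StrongDual ℂ C(K, ℂ))}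

/-- The largest ideal of `C(K)` whose elements multiply `φ` into `E`. The points outside its
zero set are those near which `φ` belongs to `E`. -/
def multiplierIdeal (φ : StrongDual ℂ C(K, ℂ)) (E : Submodule ℂ (StrongDual ℂ C(K, ℂ))) :
    Ideal C(K, ℂ) where
  carrier := {g | ∀ h, mulDual φ (g * h) ∈ E}
  add_mem' ha hb h := by
    rw [add_mul, map_add]
    exact E.add_mem (ha h) (hb h)
  zero_mem' h := by
    rw [zero_mul, map_zero]
    exact E.zero_mem
  smul_mem' c g hg h := by
    rw [smul_eq_mul, mul_comm c g, mul_assoc]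
    exact hg _

theorem mulDual_mem_of_mem_multiplierIdeal {g : C(K, ℂ)} (hg : g ∈ multiplierIdeal φ E) :
    mulDual φ g ∈ E := by
  simpa only [mul_one] using hg 1

theorem isClosed_multiplierIdeal (hE : IsClosed (E : Set (StrongDual ℂ C(K, ℂ)))) :
    IsClosed (multiplierIdeal φ E : Set C(K, ℂ)) := by
  have : (multiplierIdeal φ E : Set C(K, ℂ)) =
      ⋂ h, (fun g => mulDual φ (g * h)) ⁻¹' E := Set.ofPred_forall _
  rw [this]
  exact isClosed_iInter fun h => hE.preimage (by fun_prop)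

variable [T2Space K]

theorem mem_of_forall_notMem_setOfIdeal {I : Ideal C(K, ℂ)} (hI : IsClosed (I : Set C(K, ℂ)))
    {g : C(K, ℂ)} (hg : ∀ k ∉ ContinuousMap.setOfIdeal I, g k = 0) : g ∈ I := by
  rw [← ContinuousMap.idealOfSet_ofIdeal_isClosed hI, ContinuousMap.mem_idealOfSet]
  exact fun k hk => hg k hk

-- At an isolated point `t` of the zero set, `g φ` is a point mass at `t` modulo `E`.
theorem mulDual_mem_of_subsingleton (hE : IsClosed (E : Set (StrongDual ℂ C(K, ℂ)))) {t : K}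
    (ht : ContinuousMap.evalCLM ℂ t ∈ E) {U : Set K} (hU : IsOpen U) (htU : t ∈ U)
    (hUt : ∀ k ∈ U, k ∉ ContinuousMap.setOfIdeal (multiplierIdeal φ E) → k = t)
    {g : C(K, ℂ)} (hg : ∀ k ∉ U, g k = 0) : mulDual φ g ∈ E := by
  refine hE.closure_subset (Metric.mem_closure_iff.mpr fun ε hε => ?_)
  obtain ⟨η, hη, hηε⟩ : ∃ η > 0, ‖g t‖ * η < ε := exists_pos_mul_lt hε ‖g t‖
  obtain ⟨b, hbt, hb, hφb⟩ := exists_norm_mulDual_sub_le φ hU htU hη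
  have hmem : g - g t • b ∈ multiplierIdeal φ E :=
    mem_of_forall_notMem_setOfIdeal (isClosed_multiplierIdeal hE) fun k hk => by
      by_cases hkU : k ∈ U
      · simp [hUt k hkU hk, hbt]
      · simp [hg k hkU, hb k hkU]
  refine ⟨mulDual φ (g - g t • b) + g t • φ b • ContinuousMap.evalCLM ℂ t,
    E.add_mem (mulDual_mem_of_mem_multiplierIdeal hmem) (E.smul_mem _ (E.smul_mem _ ht)), ?_⟩
  calc dist (mulDual φ g) (mulDual φ (g - g t • b) + g t • φ b • ContinuousMap.evalCLM ℂ t)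
      = ‖g t • (mulDual φ b - φ b • ContinuousMap.evalCLM ℂ t)‖ := by
        rw [dist_eq_norm, map_sub, map_smul, smul_sub]
        congr 1
        abel
    _ ≤ ‖g t‖ * η := (norm_smul_le _ _).trans (by gcongr)
    _ < ε := hηε

theorem perfect_compl_setOfIdeal_multiplierIdeal
    (hE : IsClosed (E : Set (StrongDual ℂ C(K, ℂ)))) (heval : ∀ t, ContinuousMap.evalCLM ℂ t ∈ E) :
    Perfect (ContinuousMap.setOfIdeal (multiplierIdeal φ E))ᶜ := by
  refine ⟨(ContinuousMap.setOfIdeal_open _).isClosed_compl, preperfect_iff_nhds.mpr ?_⟩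
  by_contra! h
  obtain ⟨t, ht, U, hU, hUt⟩ := h
  have htU : t ∈ interior U := mem_interior_iff_mem_nhds.mpr hU
  obtain ⟨b, hbt, hb, -⟩ := exists_norm_mulDual_sub_le φ isOpen_interior htU one_pos
  have hbmem : b ∈ multiplierIdeal φ E := fun h =>
    mulDual_mem_of_subsingleton hE (heval t) isOpen_interior htU
      (fun k hkU hk => hUt k ⟨interior_subset hkU, hk⟩) fun k hk => by simp [hb k hk]
  exact one_ne_zero (hbt.symm.trans (ContinuousMap.notMem_setOfIdeal.mp ht hbmem))

theorem IsDispersed.topologicalClosure_span_eval (hK : IsDispersed K) :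
    (Submodule.span ℂ (Set.range fun t : K =>
      (ContinuousMap.evalCLM ℂ t : StrongDual ℂ C(K, ℂ)))).topologicalClosure = ⊤ := by
  refine eq_top_iff.mpr fun φ _ => ?_
  set E := (Submodule.span ℂ (Set.range fun t : K =>
    (ContinuousMap.evalCLM ℂ t : StrongDual ℂ C(K, ℂ)))).topologicalClosure
  have hE : IsClosed (E : Set (StrongDual ℂ C(K, ℂ))) := Submodule.isClosed_topologicalClosure _
  have heval : ∀ t : K, ContinuousMap.evalCLM ℂ t ∈ E := fun t =>
    Submodule.le_topologicalClosure _ (Submodule.subset_span ⟨t, rfl⟩)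
  have hempty := hK _ (perfect_compl_setOfIdeal_multiplierIdeal (φ := φ) hE heval)
  have hone : (1 : C(K, ℂ)) ∈ multiplierIdeal φ E :=
    mem_of_forall_notMem_setOfIdeal (isClosed_multiplierIdeal hE) fun k hk =>
      absurd (hempty ▸ hk : k ∈ (∅ : Set K)) (Set.notMem_empty k)
  exact mulDual_one φ ▸ mulDual_mem_of_mem_multiplierIdeal hone

end PointEvaluations

section ClusterSet

theorem exists_characterSpace_tendsto_ultrafilter {α : Type*} [TopologicalSpace α]
    (A : Subalgebra ℂ (α →ᵇ ℂ)) (𝒰 : Ultrafilter α) :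
    ∃ τ : WeakDual.characterSpace ℂ A, ∀ f : A, Tendsto f.1 𝒰 (𝓝 (τ f)) := by
  choose τ hτ_le hτ using fun f : A =>
    exists_norm_le_tendsto_ultrafilter 𝒰 (Eventually.of_forall f.1.norm_coe_le_norm)
  let T : StrongDual ℂ A := LinearMap.mkContinuous
    { toFun := τ
      map_add' f g := tendsto_nhds_unique (hτ (f + g)) ((hτ f).add (hτ g))
      map_smul' c f := tendsto_nhds_unique (hτ (c • f)) ((hτ f).const_smul c) } 1
    fun f => (hτ_le f).trans_eq (one_mul _).symm
  have hT_one : T 1 = 1 := tendsto_nhds_unique (hτ 1) tendsto_const_nhds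
  have hT_ne : StrongDual.toWeakDual T ≠ 0 := fun h =>
    one_ne_zero (hT_one.symm.trans (DFunLike.congr_fun h 1))
  have hT_mul : ∀ f g, T (f * g) = T f * T g := fun f g =>
    tendsto_nhds_unique (hτ (f * g)) ((hτ f).mul (hτ g))
  exact ⟨⟨StrongDual.toWeakDual T, hT_ne, hT_mul⟩, hτ⟩

variable {X : Type*} [NormedAddCommGroup X] [NormedSpace ℂ X]

theorem tendsto_toWeakStarBidual_iff {l : Filter (UnitBall X)} {x : StrongDual ℂ (StrongDual ℂ X)} :
    Tendsto toWeakStarBidual l (𝓝 (StrongDual.toWeakDual x)) ↔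
      ∀ φ : StrongDual ℂ X, Tendsto (fun b : UnitBall X => φ b) l (𝓝 (x φ)) :=
  tendsto_iff_forall_eval_tendsto_topDualPairing

theorem clusterSet_subset_image_fiber (f : HInf X) (x : StrongDual ℂ (StrongDual ℂ X)) :
    clusterSet f x ⊆ WeakDual.gelfandTransform ℂ (HInf X) f '' fiber x := by
  rintro z ⟨l, hl, hlx, hlz⟩
  have h𝒰 : (Ultrafilter.of l : Filter (UnitBall X)) ≤ l := Ultrafilter.of_le l
  obtain ⟨τ, hτ⟩ := exists_characterSpace_tendsto_ultrafilter (HInf X) (Ultrafilter.of l)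
  refine ⟨τ, ContinuousLinearMap.ext fun φ => ?_, tendsto_nhds_unique (hτ f) (hlz.mono_left h𝒰)⟩
  exact tendsto_nhds_unique (hτ (restrictFun φ))
    ((tendsto_toWeakStarBidual_iff.mp hlx φ).mono_left h𝒰)

theorem equicontinuous_apply_unitBall :
    Equicontinuous fun (b : UnitBall X) (φ : StrongDual ℂ X) => φ b :=
  (LipschitzWith.uniformEquicontinuous _ 1 fun b => LipschitzWith.of_dist_le_mul fun φ ψ => by
    rw [dist_eq_norm, dist_eq_norm, ← _root_.sub_apply, NNReal.coe_one, one_mul]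
    exact ((φ - ψ).le_opNorm_of_le (mem_ball_zero_iff.mp b.2).le).trans_eq
      (mul_one _)).equicontinuous

theorem tendsto_toWeakStarBidual_of_topologicalClosure_span {l : Filter (UnitBall X)}
    {x : StrongDual ℂ (StrongDual ℂ X)} {s : Set (StrongDual ℂ X)}
    (hs : (Submodule.span ℂ s).topologicalClosure = ⊤)
    (h : ∀ φ ∈ s, Tendsto (fun b : UnitBall X => φ b) l (𝓝 (x φ))) :
    Tendsto toWeakStarBidual l (𝓝 (StrongDual.toWeakDual x)) := by
  rw [tendsto_toWeakStarBidual_iff]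
  have hspan : ∀ φ ∈ Submodule.span ℂ s,
      Tendsto (fun b : UnitBall X => φ b) l (𝓝 (x φ)) := fun φ hφ => by
    induction hφ using Submodule.span_induction with
    | mem φ hφ => exact h φ hφ
    | zero => simpa using tendsto_const_nhds
    | add φ ψ _ _ hφ hψ => simpa using hφ.add hψ
    | smul c φ _ hφ => simpa using hφ.const_mul c
  exact fun φ => closure_minimal hspan
    (equicontinuous_apply_unitBall.isClosed_setOfPred_tendsto x.continuous)
    (hs ▸ Submodule.mem_top : φ ∈ (Submodule.span ℂ s).topologicalClosure)

variable {K : Type*} [TopologicalSpace K] [CompactSpace K]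

theorem norm_apply_evalCLM_le_one {x : StrongDual ℂ (StrongDual ℂ C(K, ℂ))} (hx : ‖x‖ ≤ 1) (t : K) :
    ‖x (ContinuousMap.evalCLM ℂ t)‖ ≤ 1 := by
  have heval : ‖(ContinuousMap.evalCLM ℂ t : StrongDual ℂ C(K, ℂ))‖ ≤ 1 :=
    ContinuousLinearMap.opNorm_le_bound _ zero_le_one fun y =>
      (y.norm_coe_le_norm t).trans_eq (one_mul _).symm
  exact (x.le_of_opNorm_le_of_le hx heval).trans_eq (one_mul 1)

variable [T2Space K]

theorem exists_filter_tendsto_of_mem_fiber {f : HInf C(K, ℂ)}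
    {x : StrongDual ℂ (StrongDual ℂ C(K, ℂ))} (hx : ‖x‖ ≤ 1)
    {τ : WeakDual.characterSpace ℂ (HInf C(K, ℂ))} (hτ : τ ∈ fiber x) :
    ∃ l : Filter (UnitBall C(K, ℂ)), l.NeBot ∧
      (∀ t, Tendsto (fun b : UnitBall C(K, ℂ) => b.1 t) l (𝓝 (x (ContinuousMap.evalCLM ℂ t)))) ∧
      Tendsto f.1 l (𝓝 (τ f)) := by
  classical
  let w : K → ℂ := fun t => x (ContinuousMap.evalCLM ℂ t)
  have happrox : ∀ p : Finset K × ℕ, ∃ b : UnitBall C(K, ℂ),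
      (∀ s ∈ p.1, ‖b.1 s - w s‖ < 1 / (p.2 + 1 : ℝ)) ∧ ‖f.1 b - τ f‖ < 1 / (p.2 + 1 : ℝ) :=
    fun p => exists_mem_cylinder_norm_sub_lt (norm_apply_evalCLM_le_one hx) (by positivity)
      (WeakDual.CharacterSpace.toAlgHom τ)
      (fun _ => congrArg (fun Φ : StrongDual ℂ (StrongDual ℂ C(K, ℂ)) => Φ _) hτ) f p.1
  choose b hb hbf using happrox
  have hlim : Tendsto (fun p : Finset K × ℕ => 1 / (p.2 + 1 : ℝ)) atTop (𝓝 0) := by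
    rw [← prod_atTop_atTop_eq]
    exact tendsto_one_div_add_atTop_nhds_zero_nat.comp tendsto_snd
  refine ⟨map b atTop, inferInstance, fun t => ?_, ?_⟩
  · refine tendsto_map'_iff.mpr (tendsto_iff_norm_sub_tendsto_zero.mpr
      (squeeze_zero' (Eventually.of_forall fun _ => norm_nonneg _) ?_ hlim))
    filter_upwards [eventually_ge_atTop (({t}, 0) : Finset K × ℕ)] with p hp
    exact (hb p t (Finset.singleton_subset_iff.mp hp.1)).le
  · exact tendsto_map'_iff.mpr (tendsto_iff_norm_sub_tendsto_zero.mpr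
      (squeeze_zero (fun _ => norm_nonneg _) (fun p => (hbf p).le) hlim))

theorem image_fiber_subset_clusterSet (hK : IsDispersed K) (f : HInf C(K, ℂ))
    {x : StrongDual ℂ (StrongDual ℂ C(K, ℂ))} (hx : ‖x‖ ≤ 1) :
    WeakDual.gelfandTransform ℂ (HInf C(K, ℂ)) f '' fiber x ⊆ clusterSet f x := by
  rintro _ ⟨τ, hτ, rfl⟩
  obtain ⟨l, hl, hlx, hlf⟩ := exists_filter_tendsto_of_mem_fiber (f := f) hx hτ
  exact ⟨l, hl, tendsto_toWeakStarBidual_of_topologicalClosure_span hK.topologicalClosure_span_eval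
    (Set.forall_mem_range.mpr hlx), hlf⟩

end ClusterSet

theorem theorem1 (K : Type*) [TopologicalSpace K] [CompactSpace K] [T2Space K]
    (hK : IsDispersed K) (x : StrongDual ℂ (StrongDual ℂ C(K, ℂ)))
    (hx : x ∈ Metric.closedBall (0 : StrongDual ℂ (StrongDual ℂ C(K, ℂ))) 1)
    (f : HInf C(K, ℂ)) :
    clusterSet f x = WeakDual.gelfandTransform ℂ (HInf C(K, ℂ)) f '' fiber x :=
  (clusterSet_subset_image_fiber f x).antisymm
    (image_fiber_subset_clusterSet hK f ((dist_zero_right x).symm.trans_le hx))
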